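/- Let $P_0(D)=\sum_{|\alpha|\le m}a_\alpha D^\alpha$, $D_j=-i\,\partial/\partial x_j$, be a partial differential operator on $\mathbb{R}^n$ of order $m\ge 2$ with constant real coefficients. Put $\widetilde P_0(\xi)=\bigl(\sum_{\alpha}|\partial^\alpha P_0(\xi)|^2\bigr)^{1/2}$ and assume that $\widetilde P_0(\xi)\to\infty$ as $|\xi|\to\infty$ and that $P_0(\xi)$ or $-P_0(\xi)$ is bounded from below on $\mathbb{R}^n$. Let $\Omega\subset\mathbb{R}^n$ be a bounded domain, and let $V\in L^\infty(\mathbb{R}^n)$ be real-valued with $\operatorname{supp}V=\overline\Omega$ and $V\ge\delta$ a.e. in $\overline\Omega$, for a constant $\delta>0$. Write $\|\cdot\|$ for the norm of $L^2(\Omega)$ (complex-valued functions). Let $H_0^{P_0}(\Omega)$ be the completion of $C_0^\infty(\Omega)$ in the norm $\|P_0(D)\varphi\|$, regarded as a subspace of $L^2(\Omega)$. A number $\lambda\in\mathbb{C}$ is a transmission eigenvalue if there are $0\ne v\in L^2_{\rm loc}(\Omega)$ and $0\ne w\in L^2_{\rm loc}(\Omega)$ with $(P_0-\lambda)v=0$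 and $(P_0+V-\lambda)w=0$ in $\mathcal{D}'(\Omega)$ and $v-w\in H_0^{P_0}(\Omega)$. The multiplicity of a real transmission eigenvalue $\lambda$ is the multiplicity of $0$ as an eigenvalue of $T_\lambda=(P_0+V-\lambda)\frac1V(P_0-\lambda)$, i.e. the dimension of $\{u\in H_0^{P_0}(\Omega): T_\lambda u=0 \text{ in }\mathcal{D}'(\Omega)\}$. Suppose that there is a $p$-dimensional subspace $V^p\subset H_0^{P_0}(\Omega)$ such that $$\delta\ \ge\ 2\,\frac{\|P_0u\|}{\|u\|}\qquad\text{for all } 0\ne u\in V^p .$$ Then there exist $p$ real transmission eigenvalues, counted with multiplicity: there are $\lambda_1,\dots,\lambda_p\in\mathbb{R}$, each of them a transmission eigenvalue, such that no value occurs among them more often than its (finite) multiplicity. -/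

import Mathlib

open MeasureTheory Set Filter Topology TopologicalSpace
open scoped Distributions ENNReal

namespace TransmissionProblem

noncomputable section

/-- The Euclidean space `ℝⁿ`. -/
abbrev Space (n : ℕ) : Type := EuclideanSpace ℝ (Fin n)

/-- Complex-valued `L²(Ω)`, with respect to Lebesgue measure. -/
abbrev L2 {n : ℕ} (Ω : Opens (Space n)) : Type :=
  Lp ℂ 2 ((volume : Measure (Space n)).restrict (Ω : Set (Space n)))

/-- `D_j = -i ∂/∂x_j`, acting on `C₀^∞(Ω)`. -/
def dOp {n : ℕ} (Ω : Opens (Space n)) (j : Fin n) : Module.End ℂ 𝓓(Ω, ℂ) :=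
  (-Complex.I) •
    (TestFunction.lineDerivCLM ℂ (EuclideanSpace.single j (1 : ℝ)) :
      𝓓(Ω, ℂ) →L[ℂ] 𝓓(Ω, ℂ)).toLinearMap

/-- `D^α = D_1^{α_1} ⋯ D_n^{α_n}`, acting on `C₀^∞(Ω)`. -/
def dPow {n : ℕ} (Ω : Opens (Space n)) (α : Fin n →₀ ℕ) : Module.End ℂ 𝓓(Ω, ℂ) :=
  (List.ofFn fun j => dOp Ω j ^ α j).prod

/-- `P(D) = ∑_α a_α D^α`, acting on `C₀^∞(Ω)`, for the real polynomial `P(ξ) = ∑_α a_α ξ^α`. -/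
def polyOp {n : ℕ} (P : MvPolynomial (Fin n) ℝ) (Ω : Opens (Space n)) :
    Module.End ℂ 𝓓(Ω, ℂ) :=
  ∑ α ∈ P.support, ((P.coeff α : ℝ) : ℂ) • dPow Ω α

/-- The real symbol `ξ ↦ P(ξ)`. -/
def symbol {n : ℕ} (P : MvPolynomial (Fin n) ℝ) (ξ : Space n) : ℝ :=
  MvPolynomial.eval (fun j => ξ j) P

/-- `∂^α P`, the formal partial derivative of the polynomial `P`. -/
def polyDeriv {n : ℕ} (α : Fin n → ℕ) (P : MvPolynomial (Fin n) ℝ) : MvPolynomial (Fin n) ℝ :=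
  (List.ofFn fun j => ((MvPolynomial.pderiv j).toLinearMap :
    Module.End ℝ (MvPolynomial (Fin n) ℝ)) ^ α j).prod P

/-- `P̃(ξ) = (∑_α |∂^α P(ξ)|²)^{1/2}`. The sum is over all multi-indices with entries at most the
degree of `P`; all other derivatives of `P` vanish identically. (Replacing `∂` by `-i∂` does not
change the absolute values.) -/
def symbolTilde {n : ℕ} (P : MvPolynomial (Fin n) ℝ) (ξ : Space n) : ℝ :=
  Real.sqrt (∑ α : Fin n → Fin (P.totalDegree + 1),
    |symbol (polyDeriv (fun j => (α j : ℕ)) P) ξ| ^ 2)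

theorem memLp_testFunction {n : ℕ} {Ω : Opens (Space n)} (φ : 𝓓(Ω, ℂ)) :
    MemLp φ 2 ((volume : Measure (Space n)).restrict (Ω : Set (Space n))) :=
  (φ.continuous.memLp_of_hasCompactSupport φ.hasCompactSupport).restrict _

/-- The inclusion `C₀^∞(Ω) → L²(Ω)`. -/
def testToL2 {n : ℕ} (Ω : Opens (Space n)) : 𝓓(Ω, ℂ) →ₗ[ℂ] L2 Ω where
  toFun φ := (memLp_testFunction φ).toLp φ
  map_add' φ ψ := by
    rw [← MemLp.toLp_add]; rfl
  map_smul' c φ := by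
    rw [RingHom.id_apply, ← MemLp.toLp_const_smul]; rfl

/-- The closure in `L²(Ω) × L²(Ω)` of the graph `{(φ, P(D)φ) : φ ∈ C₀^∞(Ω)}`. -/
def minGraph {n : ℕ} (P : MvPolynomial (Fin n) ℝ) (Ω : Opens (Space n)) :
    Submodule ℂ (L2 Ω × L2 Ω) :=
  (LinearMap.range ((testToL2 Ω).prod (testToL2 Ω ∘ₗ polyOp P Ω))).topologicalClosure

theorem dOp_apply {n : ℕ} {Ω : Opens (Space n)} (j : Fin n) (φ : 𝓓(Ω, ℂ)) (x : Space n) :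
    dOp Ω j φ x = -Complex.I * fderiv ℝ φ x (EuclideanSpace.single j (1 : ℝ)) := by
  have hd : DifferentiableAt ℝ φ x := (φ.contDiff.differentiable (by simp)).differentiableAt
  have h : (TestFunction.lineDerivCLM ℂ (EuclideanSpace.single j (1 : ℝ)) φ : 𝓓(Ω, ℂ)) x =
      fderiv ℝ φ x (EuclideanSpace.single j (1 : ℝ)) := by
    rw [TestFunction.lineDerivCLM_apply_of_le (by simp), hd.lineDeriv_eq_fderiv]
  rw [← h]
  rfl

theorem inner_testToL2 {n : ℕ} {Ω : Opens (Space n)} (φ : 𝓓(Ω, ℂ)) (f : L2 Ω) :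
    inner ℂ (testToL2 Ω φ) f = ∫ x in (Ω : Set (Space n)), f x * starRingEnd ℂ (φ x) := by
  rw [MeasureTheory.L2.inner_def]
  refine integral_congr_ae ?_
  filter_upwards [MemLp.coeFn_toLp (memLp_testFunction φ)] with x hx
  simp only [testToL2, LinearMap.coe_mk, AddHom.coe_mk, hx]
  rfl

theorem inner_testToL2_testToL2 {n : ℕ} {Ω : Opens (Space n)} (φ ψ : 𝓓(Ω, ℂ)) :
    inner ℂ (testToL2 Ω φ) (testToL2 Ω ψ) = ∫ x, starRingEnd ℂ (φ x) * ψ x := by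
  have hΩ : ∫ x in (Ω : Set (Space n)), starRingEnd ℂ (φ x) * ψ x =
      ∫ x, starRingEnd ℂ (φ x) * ψ x := by
    refine setIntegral_eq_integral_of_forall_compl_eq_zero fun x hx => ?_
    have : φ x = 0 := image_eq_zero_of_notMem_tsupport fun h => hx (φ.tsupport_subset h)
    simp [this]
  rw [inner_testToL2, ← hΩ]
  · refine integral_congr_ae ?_
    filter_upwards [MemLp.coeFn_toLp (memLp_testFunction ψ)] with x hx
    simp only [testToL2, LinearMap.coe_mk, AddHom.coe_mk, hx]
    ring

theorem dOp_symm {n : ℕ} {Ω : Opens (Space n)} (j : Fin n) (φ ψ : 𝓓(Ω, ℂ)) :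
    inner ℂ (testToL2 Ω φ) (testToL2 Ω (dOp Ω j ψ)) =
      inner ℂ (testToL2 Ω (dOp Ω j φ)) (testToL2 Ω ψ) := by
  set e : Space n := EuclideanSpace.single j (1 : ℝ)
  have hφ : ContDiff ℝ 1 φ := φ.contDiff.of_le (by exact_mod_cast le_top)
  have hψ : ContDiff ℝ 1 ψ := ψ.contDiff.of_le (by exact_mod_cast le_top)
  have hφ' : Continuous fun x => fderiv ℝ φ x e :=
    (hφ.continuous_fderiv one_ne_zero).clm_apply continuous_const
  have hψ' : Continuous fun x => fderiv ℝ ψ x e :=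
    (hψ.continuous_fderiv one_ne_zero).clm_apply continuous_const
  have key := integral_bilinear_hasFDerivAt_right_eq_neg_left_of_integrable
    (μ := (volume : Measure (Space n))) (v := e)
    (B := (ContinuousLinearMap.mul ℝ ℂ).comp (Complex.conjCLE : ℂ →L[ℝ] ℂ))
    (f := φ) (f' := fderiv ℝ φ) (g := ψ) (g' := fderiv ℝ ψ) ?_ ?_ ?_
    (fun x _ => (hφ.differentiable one_ne_zero x).hasFDerivAt)
    (fun x _ => (hψ.differentiable one_ne_zero x).hasFDerivAt)
  · simp only [inner_testToL2_testToL2, dOp_apply]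
    simp only [ContinuousLinearMap.comp_apply, ContinuousLinearMap.mul_apply',
      ContinuousLinearEquiv.coe_coe, Complex.conjCLE_apply] at key
    calc ∫ x, starRingEnd ℂ (φ x) * (-Complex.I * fderiv ℝ ψ x e)
        = -Complex.I * ∫ x, starRingEnd ℂ (φ x) * fderiv ℝ ψ x e := by
          rw [← integral_const_mul]; congr 1; ext x; ring
      _ = Complex.I * ∫ x, starRingEnd ℂ (fderiv ℝ φ x e) * ψ x := by rw [key]; ring
      _ = _ := by
          rw [← integral_const_mul]; congr 1; ext x
          simp only [map_mul, map_neg, Complex.conj_I]; ring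
  · exact (by fun_prop : Continuous _).integrable_of_hasCompactSupport
      (ψ.hasCompactSupport.mono fun x hx h => hx (by simp [h]))
  · exact (by fun_prop : Continuous _).integrable_of_hasCompactSupport
      (φ.hasCompactSupport.mono fun x hx h => hx (by simp [h]))
  · exact (by fun_prop : Continuous _).integrable_of_hasCompactSupport
      (ψ.hasCompactSupport.mono fun x hx h => hx (by simp [h]))

theorem exists_adjoint_list {n : ℕ} {Ω : Opens (Space n)} (l : List (Module.End ℂ 𝓓(Ω, ℂ)))
    (hl : ∀ A ∈ l, ∃ B : 𝓓(Ω, ℂ) → 𝓓(Ω, ℂ), ∀ φ ψ,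
      inner ℂ (testToL2 Ω φ) (testToL2 Ω (A ψ)) = inner ℂ (testToL2 Ω (B φ)) (testToL2 Ω ψ)) :
    ∃ B : 𝓓(Ω, ℂ) → 𝓓(Ω, ℂ), ∀ φ ψ,
      inner ℂ (testToL2 Ω φ) (testToL2 Ω (l.prod ψ)) =
        inner ℂ (testToL2 Ω (B φ)) (testToL2 Ω ψ) := by
  induction l with
  | nil => exact ⟨id, fun φ ψ => rfl⟩
  | cons A l ih =>
    obtain ⟨B, hB⟩ := hl A (by simp)
    obtain ⟨C, hC⟩ := ih fun A hA => hl A (by simp [hA])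
    refine ⟨fun φ => C (B φ), fun φ ψ => ?_⟩
    rw [List.prod_cons, Module.End.mul_apply, hB, hC]

theorem exists_adjoint_polyOp {n : ℕ} (P : MvPolynomial (Fin n) ℝ) (Ω : Opens (Space n)) :
    ∃ B : 𝓓(Ω, ℂ) → 𝓓(Ω, ℂ), ∀ φ ψ,
      inner ℂ (testToL2 Ω φ) (testToL2 Ω (polyOp P Ω ψ)) =
        inner ℂ (testToL2 Ω (B φ)) (testToL2 Ω ψ) := by
  have h : ∀ α : Fin n →₀ ℕ, ∃ B : 𝓓(Ω, ℂ) → 𝓓(Ω, ℂ), ∀ φ ψ,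
      inner ℂ (testToL2 Ω φ) (testToL2 Ω (dPow Ω α ψ)) =
        inner ℂ (testToL2 Ω (B φ)) (testToL2 Ω ψ) := fun α => by
    refine exists_adjoint_list _ fun A hA => ?_
    obtain ⟨j, rfl⟩ := (List.mem_ofFn' _ _).1 hA
    have := exists_adjoint_list (List.replicate (α j) (dOp Ω j)) fun A hA => by
      rw [List.eq_of_mem_replicate hA]
      exact ⟨dOp Ω j, dOp_symm j⟩
    simpa only [List.prod_replicate] using this
  choose B hB using h
  refine ⟨fun φ => ∑ α ∈ P.support, ((P.coeff α : ℝ) : ℂ) • B α φ, fun φ ψ => ?_⟩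
  simp only [polyOp, LinearMap.sum_apply, LinearMap.smul_apply, map_sum, map_smul, inner_sum,
    sum_inner, inner_smul_left, inner_smul_right, hB, Complex.conj_ofReal]

/-- The operator `P(D)` on `C₀^∞(Ω)` is closable in `L²(Ω)`. -/
theorem minGraph_single_valued {n : ℕ} (P : MvPolynomial (Fin n) ℝ) (Ω : Opens (Space n))
    (z : L2 Ω × L2 Ω) (hz : z ∈ minGraph P Ω) (hz1 : z.1 = 0) : z.2 = 0 := by
  obtain ⟨B, hB⟩ := exists_adjoint_polyOp P Ω
  have h0 : ∀ φ : 𝓓(Ω, ℂ), inner ℂ (testToL2 Ω φ) z.2 = inner ℂ (testToL2 Ω (B φ)) z.1 := by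
    intro φ
    have hcl : IsClosed {z : L2 Ω × L2 Ω |
        inner ℂ (testToL2 Ω φ) z.2 = inner ℂ (testToL2 Ω (B φ)) z.1} :=
      isClosed_eq (continuous_const.inner continuous_snd) (continuous_const.inner continuous_fst)
    refine closure_minimal ?_ hcl hz
    rintro _ ⟨ψ, rfl⟩
    exact hB φ ψ
  have hloc : LocallyIntegrableOn z.2 (Ω : Set (Space n)) volume := by
    intro x hx
    obtain ⟨K, hK, hxK, hKΩ⟩ := exists_compact_subset Ω.isOpen hx
    refine ⟨K, mem_nhdsWithin_of_mem_nhds (mem_interior_iff_mem_nhds.1 hxK), ?_⟩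
    have hm : MemLp z.2 2 (volume.restrict K) :=
      (Lp.memLp z.2).mono_measure (Measure.restrict_mono hKΩ le_rfl)
    have : IsFiniteMeasure ((volume : Measure (Space n)).restrict K) :=
      ⟨by simpa using hK.measure_lt_top⟩
    exact hm.integrable (by norm_num)
  have := Ω.isOpen.ae_eq_zero_of_integral_contDiff_smul_eq_zero hloc fun g hg hgc hgs => by
    let φ : 𝓓(Ω, ℂ) := ⟨fun x => (g x : ℂ), Complex.ofRealCLM.contDiff.comp hg,
      hgc.comp_left (g := fun t : ℝ => (t : ℂ)) (by simp),
      (closure_mono (Function.support_comp_subset (g := fun t : ℝ => (t : ℂ))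
        Complex.ofReal_zero g)).trans hgs⟩
    have h := h0 φ
    rw [hz1, inner_zero_right, inner_testToL2,
      setIntegral_eq_integral_of_forall_compl_eq_zero] at h
    · rw [← h]
      congr 1; ext x
      change (g x : ℝ) • z.2 x = z.2 x * starRingEnd ℂ (g x : ℂ)
      rw [Complex.conj_ofReal, Complex.real_smul, mul_comm]
    · intro x hx
      have : φ x = 0 := image_eq_zero_of_notMem_tsupport fun h => hx (φ.tsupport_subset h)
      simp [this]
  refine (Lp.eq_zero_iff_ae_eq_zero).2 ?_
  exact (ae_restrict_iff' Ω.isOpen.measurableSet).2 this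

/-- `P₀` as a closed operator in `L²(Ω)` with domain `H₀^{P₀}(Ω)`: the closure of `P₀(D)` on
`C₀^∞(Ω)`. The closure of the graph is again a graph, see `minGraph_single_valued`. -/
def minOp {n : ℕ} (P : MvPolynomial (Fin n) ℝ) (Ω : Opens (Space n)) : L2 Ω →ₗ.[ℂ] L2 Ω :=
  (minGraph P Ω).toLinearPMap

/-- `H₀^{P₀}(Ω)`, the completion of `C₀^∞(Ω)` in the norm `‖P₀(D)φ‖`, realised inside `L²(Ω)`:
`u` belongs to it iff there are `φ_k ∈ C₀^∞(Ω)` with `φ_k → u` and `P₀(D)φ_k` convergent in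
`L²(Ω)`; the limit of `P₀(D)φ_k` is `P₀u = minOp P Ω u`. For bounded `Ω` and `P₀ ≠ 0` one has
`‖φ‖ ≤ C ‖P₀(D)φ‖` on `C₀^∞(Ω)`, so that sequences which are Cauchy for `‖P₀(D)φ‖` are exactly
those for which both `φ_k` and `P₀(D)φ_k` converge in `L²(Ω)`. -/
abbrev H0 {n : ℕ} (P : MvPolynomial (Fin n) ℝ) (Ω : Opens (Space n)) : Submodule ℂ (L2 Ω) :=
  (minOp P Ω).domain

/-- `(P(D) + V - lam) g = 0` in `𝓓'(Ω)`: for every test function `φ`,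
`∫_Ω g · conj ((P(D) + V - conj lam) φ) = 0`, the integral being convergent. Since `P` and `V` are
real and `conj φ` runs over all test functions, this is the distributional equation. -/
def WeakSol {n : ℕ} (P : MvPolynomial (Fin n) ℝ) (Ω : Opens (Space n)) (V : Space n → ℝ)
    (lam : ℂ) (g : Space n → ℂ) : Prop :=
  ∀ φ : 𝓓(Ω, ℂ),
    IntegrableOn (fun x => g x * starRingEnd ℂ
      (polyOp P Ω φ x + (V x : ℂ) * φ x - starRingEnd ℂ lam * φ x)) Ω volume ∧
    ∫ x in (Ω : Set (Space n)), g x * starRingEnd ℂ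
      (polyOp P Ω φ x + (V x : ℂ) * φ x - starRingEnd ℂ lam * φ x) = 0

/-- `g ∈ L²_loc(Ω)`. -/
def L2Loc {n : ℕ} (Ω : Opens (Space n)) (g : Space n → ℂ) : Prop :=
  ∀ K : Set (Space n), IsCompact K → K ⊆ Ω → MemLp g 2 (volume.restrict K)

/-- `lam` is a (interior) transmission eigenvalue: there are `0 ≠ v, w ∈ L²_loc(Ω)` with
`(P₀ - lam) v = 0` and `(P₀ + V - lam) w = 0` in `Ω`, and `v - w ∈ H₀^{P₀}(Ω)`. -/
def IsTransmissionEigenvalue {n : ℕ} (P : MvPolynomial (Fin n) ℝ) (Ω : Opens (Space n))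
    (V : Space n → ℝ) (lam : ℂ) : Prop :=
  ∃ v w : Space n → ℂ, L2Loc Ω v ∧ L2Loc Ω w ∧
    ¬ (v =ᵐ[volume.restrict (Ω : Set (Space n))] 0) ∧
    ¬ (w =ᵐ[volume.restrict (Ω : Set (Space n))] 0) ∧
    WeakSol P Ω 0 lam v ∧ WeakSol P Ω V lam w ∧
    ∃ u : H0 P Ω, v - w =ᵐ[volume.restrict (Ω : Set (Space n))] (u : L2 Ω)

/-- `(1/V) (P₀ - lam) u`, for `u ∈ H₀^{P₀}(Ω)`. -/
def innerFactor {n : ℕ} (P : MvPolynomial (Fin n) ℝ) (Ω : Opens (Space n)) (V : Space n → ℝ)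
    (lam : ℂ) (u : H0 P Ω) : Space n → ℂ :=
  fun x => ((V x : ℂ))⁻¹ * (minOp P Ω u x - lam * (u : L2 Ω) x)

theorem innerFactor_add {n : ℕ} (P : MvPolynomial (Fin n) ℝ) (Ω : Opens (Space n))
    (V : Space n → ℝ) (lam : ℂ) (u u' : H0 P Ω) :
    innerFactor P Ω V lam (u + u') =ᵐ[volume.restrict (Ω : Set (Space n))]
      fun x => innerFactor P Ω V lam u x + innerFactor P Ω V lam u' x := by
  have h1 := Lp.coeFn_add (minOp P Ω u) (minOp P Ω u')
  have h2 := Lp.coeFn_add (u : L2 Ω) (u' : L2 Ω)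
  filter_upwards [h1, h2] with x h1 h2
  simp only [innerFactor, LinearPMap.map_add, Submodule.coe_add, h1, h2, Pi.add_apply]
  ring

theorem innerFactor_smul {n : ℕ} (P : MvPolynomial (Fin n) ℝ) (Ω : Opens (Space n))
    (V : Space n → ℝ) (lam c : ℂ) (u : H0 P Ω) :
    innerFactor P Ω V lam (c • u) =ᵐ[volume.restrict (Ω : Set (Space n))]
      fun x => c * innerFactor P Ω V lam u x := by
  have h1 := Lp.coeFn_smul c (minOp P Ω u)
  have h2 := Lp.coeFn_smul c (u : L2 Ω)
  filter_upwards [h1, h2] with x h1 h2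
  simp only [innerFactor, LinearPMap.map_smul, Submodule.coe_smul, h1, h2, Pi.smul_apply,
    smul_eq_mul]
  ring

theorem WeakSol.congr {n : ℕ} {P : MvPolynomial (Fin n) ℝ} {Ω : Opens (Space n)}
    {V : Space n → ℝ} {lam : ℂ} {g g' : Space n → ℂ} (h : WeakSol P Ω V lam g)
    (hg : g' =ᵐ[volume.restrict (Ω : Set (Space n))] g) : WeakSol P Ω V lam g' := by
  intro φ
  have e := hg.mul (EventuallyEq.refl _ (fun x => starRingEnd ℂ
      (polyOp P Ω φ x + (V x : ℂ) * φ x - starRingEnd ℂ lam * φ x)))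
  exact ⟨(h φ).1.congr e.symm, (integral_congr_ae e).trans (h φ).2⟩

theorem WeakSol.add {n : ℕ} {P : MvPolynomial (Fin n) ℝ} {Ω : Opens (Space n)}
    {V : Space n → ℝ} {lam : ℂ} {g g' : Space n → ℂ} (h : WeakSol P Ω V lam g)
    (h' : WeakSol P Ω V lam g') : WeakSol P Ω V lam (fun x => g x + g' x) := by
  intro φ
  simp only [add_mul]
  exact ⟨(h φ).1.add (h' φ).1, by rw [integral_add (h φ).1 (h' φ).1, (h φ).2, (h' φ).2, add_zero]⟩

theorem WeakSol.smul {n : ℕ} {P : MvPolynomial (Fin n) ℝ} {Ω : Opens (Space n)}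
    {V : Space n → ℝ} {lam : ℂ} {g : Space n → ℂ} (c : ℂ) (h : WeakSol P Ω V lam g) :
    WeakSol P Ω V lam (fun x => c * g x) := by
  intro φ
  simp only [mul_assoc]
  exact ⟨(h φ).1.const_mul c, by rw [integral_const_mul, (h φ).2, mul_zero]⟩

/-- The kernel of `T_lam = (P₀ + V - lam) (1/V) (P₀ - lam)`: all `u ∈ H₀^{P₀}(Ω)` with
`T_lam u = 0` in `𝓓'(Ω)`. Such `u` automatically lie in the operator domain
`{u ∈ H₀^{P₀}(Ω) : P₀ ((1/V) P₀ - lam/V) u ∈ L²(Ω)}` of `T_lam`. -/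
def kerT {n : ℕ} (P : MvPolynomial (Fin n) ℝ) (Ω : Opens (Space n)) (V : Space n → ℝ)
    (lam : ℂ) : Submodule ℂ (H0 P Ω) where
  carrier := {u | WeakSol P Ω V lam (innerFactor P Ω V lam u)}
  zero_mem' := by
    have h : innerFactor P Ω V lam 0 =ᵐ[volume.restrict (Ω : Set (Space n))] fun _ => 0 := by
      have := innerFactor_smul P Ω V lam 0 0
      simpa using this
    exact WeakSol.congr (fun φ => by simp) h
  add_mem' hu hu' := (hu.add hu').congr (innerFactor_add P Ω V lam _ _)
  smul_mem' c _ hu := (hu.smul c).congr (innerFactor_smul P Ω V lam c _)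

/-- The multiplicity of the (real) transmission eigenvalue `lam`: the multiplicity of `0` as an
eigenvalue of the self-adjoint operator `T_lam`, i.e. the dimension of its kernel. -/
def multiplicity {n : ℕ} (P : MvPolynomial (Fin n) ℝ) (Ω : Opens (Space n)) (V : Space n → ℝ)
    (lam : ℝ) : ℕ :=
  Module.finrank ℂ (kerT P Ω V (lam : ℂ))

/-- The support of (the distribution given by) an almost everywhere defined function: the
complement of the largest open set on which it vanishes almost everywhere. -/
def essSupport {n : ℕ} (V : Space n → ℝ) : Set (Space n) :=
  {x | ∀ U ∈ 𝓝 x, ¬ ∀ᵐ y ∂(volume.restrict U), V y = 0}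

end

end TransmissionProblem

/-!
On `H₀^P(Ω)` with the graph norm, `T_l` is represented by a bounded self-adjoint operator `A l`,
that of the form `⟪V⁻¹ (P - l) u, (P - l) v⟫ + ⟪(P - l) u, v⟫`. It depends continuously on `l`
and, since `H₀^P(Ω)` embeds compactly in `L²(Ω)`, it is coercive modulo finite rank. If `P` is
bounded from below, the form is positive definite for very negative `l`, while at `l = δ / 2` it
is at most `δ⁻¹ ‖P u‖² - (δ / 4) ‖u‖²`, hence nonpositive on the given `p`-dimensional subspace.
Between these two parameters the largest dimension of a subspace on which the form is nonpositive
rises from `0` to at least `p`, and at each `l` it rises by at most `dim ker (A l)`. If `-P` is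
bounded from below, the same happens for `l` decreasing from a large value to `δ / 2`.

Compactness comes from Hörmander's inequality `‖P^(α)(D) φ‖ ≤ C ‖P(D) φ‖`: since `P̃ → ∞`, it
makes the high frequencies of `φ` small compared with `P(D) φ`. A kernel element `u` gives the
solutions `w = V⁻¹ (P - l) u` and `v = w + u`. If one of them vanished, then `|(P - l) u| ≤ M
|u|`, and this forces `u = 0` by a Carleman estimate with the weights `e^{τ x_j}`, obtained from
Hörmander's inequality for the shifted polynomials `P(ξ + t)` with a constant that does not depend
on `t`.
-/

namespace TransmissionProblem

noncomputable section

/-! ### Kernels along paths of quadratic forms -/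

theorem finrank_le_of_disjoint_ker {K M M' : Type*} [DivisionRing K] [AddCommGroup M]
    [Module K M] [AddCommGroup M'] [Module K M'] [FiniteDimensional K M'] {F : Submodule K M}
    (T : M →ₗ[K] M') (hF : Disjoint F T.ker) :
    FiniteDimensional K F ∧ Module.finrank K F ≤ Module.finrank K M' := by
  have hinj : Function.Injective (T.domRestrict F) :=
    LinearMap.injective_domRestrict_iff.2 hF
  exact ⟨Module.Finite.of_injective _ hinj, LinearMap.finrank_le_finrank_of_injective hinj⟩

section QuadraticForms

variable {𝕜 H : Type*} [RCLike 𝕜] [NormedAddCommGroup H] [InnerProductSpace 𝕜 H]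

theorem reApplyInnerSelf_parallelogram (A : H →L[𝕜] H) (x y : H) :
    A.reApplyInnerSelf (x + y) + A.reApplyInnerSelf (x - y) =
      2 * A.reApplyInnerSelf x + 2 * A.reApplyInnerSelf y := by
  simp only [ContinuousLinearMap.reApplyInnerSelf_apply, map_add, map_sub, inner_add_left,
    inner_add_right, inner_sub_left, inner_sub_right]
  ring

theorem reApplyInnerSelf_add_of_inner_eq_zero {A : H →L[𝕜] H}
    (hA : (A : H →ₗ[𝕜] H).IsSymmetric) {x y : H} (hxy : inner 𝕜 (A x) y = 0) :
    A.reApplyInnerSelf (x + y) = A.reApplyInnerSelf x + A.reApplyInnerSelf y := by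
  have hyx : inner 𝕜 (A y) x = 0 := by
    rw [hA.apply_clm, ← inner_conj_symm, hxy, map_zero]
  simp [ContinuousLinearMap.reApplyInnerSelf_apply, inner_add_left, inner_add_right, hxy, hyx]

theorem reApplyInnerSelf_le_add_norm_sub (A B : H →L[𝕜] H) (u : H) :
    A.reApplyInnerSelf u ≤ B.reApplyInnerSelf u + ‖A - B‖ * ‖u‖ ^ 2 := by
  have h : RCLike.re (inner 𝕜 ((A - B) u) u) ≤ ‖A - B‖ * ‖u‖ ^ 2 := calc
    _ ≤ ‖(A - B) u‖ * ‖u‖ := re_inner_le_norm _ _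
    _ ≤ ‖A - B‖ * ‖u‖ * ‖u‖ := by gcongr; exact (A - B).le_opNorm u
    _ = ‖A - B‖ * ‖u‖ ^ 2 := by ring
  simp only [sub_apply, inner_sub_left, map_sub] at h
  simp only [ContinuousLinearMap.reApplyInnerSelf_apply]
  linarith

theorem continuous_reApplyInnerSelf_uncurry :
    Continuous fun z : (H →L[𝕜] H) × H => z.1.reApplyInnerSelf z.2 := by
  simp only [ContinuousLinearMap.reApplyInnerSelf_apply]
  fun_prop

theorem norm_inner_sq_le_of_nonneg_on {A : H →L[𝕜] H} (hA : (A : H →ₗ[𝕜] H).IsSymmetric)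
    {Y : Submodule 𝕜 H} (hY : ∀ u ∈ Y, 0 ≤ A.reApplyInnerSelf u) {x y : H} (hx : x ∈ Y)
    (hy : y ∈ Y) :
    ‖inner 𝕜 (A x) y‖ ^ 2 ≤ A.reApplyInnerSelf x * A.reApplyInnerSelf y := by
  let core : PreInnerProductSpace.Core 𝕜 Y :=
    { inner := fun u v => inner 𝕜 (A u) v
      conj_inner_symm := fun u v => hA.conj_inner_sym v u
      re_inner_nonneg := fun u => hY u u.2
      add_left := fun u v w => by simp [inner_add_left]
      smul_left := fun u v c => by simp [inner_smul_left] }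
  have cauchy_schwarz : ‖inner 𝕜 (A x) y‖ * ‖inner 𝕜 (A y) x‖ ≤
      A.reApplyInnerSelf x * A.reApplyInnerSelf y :=
    @InnerProductSpace.Core.inner_mul_inner_self_le 𝕜 Y _ _ _ core ⟨x, hx⟩ ⟨y, hy⟩
  rwa [hA.apply_clm y x, norm_inner_symm y, ← sq] at cauchy_schwarz

/-- The quadratic form `u ↦ re ⟪A u, u⟫` is nonpositive on `E`. -/
def NonposOn (A : H →L[𝕜] H) (E : Submodule 𝕜 H) : Prop :=
  ∀ u ∈ E, A.reApplyInnerSelf u ≤ 0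

/-- The quadratic form `u ↦ re ⟪A u, u⟫` is negative definite on `E`. -/
def NegDefOn (A : H →L[𝕜] H) (E : Submodule 𝕜 H) : Prop :=
  ∀ u ∈ E, u ≠ 0 → A.reApplyInnerSelf u < 0

/-- The quadratic form `u ↦ re ⟪A u, u⟫` dominates a multiple of `‖u‖²` up to the square of a
finite-rank operator. For self-adjoint `A` this says that the essential spectrum of `A` lies in
`(0, ∞)`. -/
def CoerciveModFiniteRank (A : H →L[𝕜] H) : Prop :=
  ∃ (k : ℕ) (T : H →L[𝕜] EuclideanSpace 𝕜 (Fin k)) (c : ℝ), 0 < c ∧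
    ∀ u, c * ‖u‖ ^ 2 ≤ A.reApplyInnerSelf u + ‖T u‖ ^ 2

/-- The orthogonal complement of `E` for the sesquilinear form `⟪A ·, ·⟫`. -/
def formOrthogonal (A : H →L[𝕜] H) (E : Submodule 𝕜 H) : Submodule 𝕜 H :=
  Eᗮ.comap (A : H →ₗ[𝕜] H)

theorem inner_eq_zero_of_mem_formOrthogonal {A : H →L[𝕜] H} {E : Submodule 𝕜 H} {x e : H}
    (hx : x ∈ formOrthogonal A E) (he : e ∈ E) : inner 𝕜 (A x) e = 0 :=
  Submodule.inner_left_of_mem_orthogonal he hx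

theorem isClosed_formOrthogonal (A : H →L[𝕜] H) (E : Submodule 𝕜 H) :
    IsClosed (formOrthogonal A E : Set H) :=
  E.isClosed_orthogonal.preimage A.continuous

theorem NegDefOn.nonposOn {A : H →L[𝕜] H} {E : Submodule 𝕜 H} (hE : NegDefOn A E) :
    NonposOn A E := fun u hu => by
  rcases eq_or_ne u 0 with rfl | hu0
  · simp [ContinuousLinearMap.reApplyInnerSelf_apply]
  · exact (hE u hu hu0).le

theorem nonposOn_ker (A : H →L[𝕜] H) : NonposOn A A.ker := fun u hu => by
  simp [ContinuousLinearMap.reApplyInnerSelf_apply, show A u = 0 from hu]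

theorem NegDefOn.eventually {A : H →L[𝕜] H} {E : Submodule 𝕜 H} [FiniteDimensional 𝕜 E]
    (hE : NegDefOn A E) : ∀ᶠ B in 𝓝 A, NegDefOn B E := by
  have : ProperSpace E := FiniteDimensional.proper 𝕜 E
  have on_sphere : ∀ᶠ B in 𝓝 A, ∀ u ∈ Metric.sphere (0 : E) 1, B.reApplyInnerSelf u < 0 := by
    refine (isCompact_sphere _ _).eventually_forall_of_forall_eventually fun u hu => ?_
    have hcont : Continuous fun z : (H →L[𝕜] H) × E => z.1.reApplyInnerSelf z.2 :=
      continuous_reApplyInnerSelf_uncurry.comp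
        (continuous_fst.prodMk (continuous_subtype_val.comp continuous_snd))
    refine (hcont.tendsto (A, u)).eventually_lt_const (hE u u.2 ?_)
    simpa using ne_zero_of_mem_unit_sphere ⟨u, hu⟩
  filter_upwards [on_sphere] with B hB u hu hu0
  have hlt := hB (((‖u‖⁻¹ : ℝ) : 𝕜) • ⟨u, hu⟩) (by
    simp [norm_smul, inv_mul_cancel₀ (norm_ne_zero_iff.2 hu0)])
  rw [Submodule.coe_smul, ContinuousLinearMap.reApplyInnerSelf_smul] at hlt
  exact neg_of_mul_neg_right hlt (sq_nonneg _)

theorem cauchySeq_of_tendsto_reApplyInnerSelf {A : H →L[𝕜] H} {F : Type*} [NormedAddCommGroup F]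
    [NormedSpace 𝕜 F] {T : H →L[𝕜] F} {c : ℝ} (hc : 0 < c)
    (hT : ∀ u, c * ‖u‖ ^ 2 ≤ A.reApplyInnerSelf u + ‖T u‖ ^ 2)
    {Y : Submodule 𝕜 H} (hY : ∀ u ∈ Y, 0 ≤ A.reApplyInnerSelf u) {u : ℕ → H}
    (huY : ∀ k, u k ∈ Y) (hqu : Tendsto (fun k => A.reApplyInnerSelf (u k)) atTop (𝓝 0))
    (hTu : CauchySeq fun k => T (u k)) : CauchySeq u := by
  set q := fun k => A.reApplyInnerSelf (u k)
  have hbound : ∀ z : ℕ × ℕ, dist (u z.1) (u z.2) ≤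
      √((2 * q z.1 + 2 * q z.2 + dist (T (u z.1)) (T (u z.2)) ^ 2) / c) := fun z => by
    refine Real.le_sqrt_of_sq_le ?_
    rw [le_div_iff₀' hc, dist_eq_norm, dist_eq_norm, ← map_sub]
    linarith [hT (u z.1 - u z.2), hY _ (Y.add_mem (huY z.1) (huY z.2)),
      reApplyInnerSelf_parallelogram A (u z.1) (u z.2)]
  have hlim : Tendsto (fun z : ℕ × ℕ =>
      √((2 * q z.1 + 2 * q z.2 + dist (T (u z.1)) (T (u z.2)) ^ 2) / c)) atTop (𝓝 0) := by
    rw [← prod_atTop_atTop_eq]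
    have h1 : Tendsto (fun z : ℕ × ℕ => q z.1) (atTop ×ˢ atTop) (𝓝 0) := hqu.comp tendsto_fst
    have h2 : Tendsto (fun z : ℕ × ℕ => q z.2) (atTop ×ˢ atTop) (𝓝 0) := hqu.comp tendsto_snd
    have h3 := cauchySeq_iff_tendsto_dist_atTop_0.1 hTu
    rw [← prod_atTop_atTop_eq] at h3
    simpa using ((((h1.const_mul 2).add (h2.const_mul 2)).add (h3.pow 2)).div_const c).sqrt
  exact cauchySeq_iff_tendsto_dist_atTop_0.2 (squeeze_zero (fun _ => dist_nonneg) hbound hlim)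

theorem exists_unit_seq_of_not_coercive {A : H →L[𝕜] H} {Y : Submodule 𝕜 H}
    (hY : ∀ u ∈ Y, 0 ≤ A.reApplyInnerSelf u)
    (hnot : ∀ γ > 0, ∃ u ∈ Y, A.reApplyInnerSelf u < γ * ‖u‖ ^ 2) :
    ∃ u : ℕ → H, (∀ k, u k ∈ Y) ∧ (∀ k, ‖u k‖ = 1) ∧
      Tendsto (fun k => A.reApplyInnerSelf (u k)) atTop (𝓝 0) := by
  have hunit : ∀ k : ℕ, ∃ u ∈ Y, ‖u‖ = 1 ∧ A.reApplyInnerSelf u ≤ 1 / ((k : ℝ) + 1) := by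
    intro k
    obtain ⟨u, hu, hlt⟩ := hnot (1 / ((k : ℝ) + 1)) (by positivity)
    have hu0 : u ≠ 0 := by
      rintro rfl
      simp [ContinuousLinearMap.reApplyInnerSelf_apply] at hlt
    have hn : 0 < ‖u‖ := norm_pos_iff.2 hu0
    refine ⟨((‖u‖⁻¹ : ℝ) : 𝕜) • u, Y.smul_mem _ hu, ?_, ?_⟩
    · simp [norm_smul, inv_mul_cancel₀ hn.ne']
    · rw [ContinuousLinearMap.reApplyInnerSelf_smul, RCLike.norm_ofReal, sq_abs]
      calc ‖u‖⁻¹ ^ 2 * A.reApplyInnerSelf u ≤ ‖u‖⁻¹ ^ 2 * (1 / ((k : ℝ) + 1) * ‖u‖ ^ 2) := by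
            gcongr
        _ = 1 / ((k : ℝ) + 1) := by field_simp
  choose u huY hu1 hqu using hunit
  exact ⟨u, huY, hu1, squeeze_zero (fun k => hY _ (huY k)) hqu
    tendsto_one_div_add_atTop_nhds_zero_nat⟩

theorem CoerciveModFiniteRank.exists_coercive_of_pos [CompleteSpace H] {A : H →L[𝕜] H}
    (hA : CoerciveModFiniteRank A) {Y : Submodule 𝕜 H} (hYc : IsClosed (Y : Set H))
    (hY : ∀ u ∈ Y, u ≠ 0 → 0 < A.reApplyInnerSelf u) :
    ∃ γ > 0, ∀ u ∈ Y, γ * ‖u‖ ^ 2 ≤ A.reApplyInnerSelf u := by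
  by_contra! hnot
  obtain ⟨m, T, c, hc, hT⟩ := hA
  have hY0 : ∀ u ∈ Y, 0 ≤ A.reApplyInnerSelf u := fun u hu => by
    rcases eq_or_ne u 0 with rfl | hu0
    · simp [ContinuousLinearMap.reApplyInnerSelf_apply]
    · exact (hY u hu hu0).le
  obtain ⟨u, huY, hu1, hqu⟩ := exists_unit_seq_of_not_coercive hY0 hnot
  obtain ⟨t, -, φ, hφ, ht⟩ := tendsto_subseq_of_bounded
    (Metric.isBounded_closedBall (x := (0 : EuclideanSpace 𝕜 (Fin m))) (r := ‖T‖))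
    (x := fun k => T (u k)) fun k => by
      simpa [hu1] using T.le_opNorm (u k)
  have hqφ := hqu.comp hφ.tendsto_atTop
  obtain ⟨v, hv⟩ := cauchySeq_tendsto_of_complete
    (cauchySeq_of_tendsto_reApplyInnerSelf hc hT hY0 (fun k => huY (φ k)) hqφ ht.cauchySeq)
  have hvY : v ∈ Y := hYc.mem_of_tendsto hv (Eventually.of_forall fun k => huY _)
  have hv1 : ‖v‖ = 1 := tendsto_nhds_unique hv.norm (by simp [hu1])
  have hqv : A.reApplyInnerSelf v = 0 :=
    tendsto_nhds_unique ((A.reApplyInnerSelf_continuous.tendsto v).comp hv) hqφ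
  exact (hY v hvY (by rintro rfl; simp at hv1)).ne' hqv

theorem CoerciveModFiniteRank.exists_finrank_le {A : H →L[𝕜] H} (hA : CoerciveModFiniteRank A) :
    ∃ k, ∀ E, NonposOn A E → FiniteDimensional 𝕜 E ∧ Module.finrank 𝕜 E ≤ k := by
  obtain ⟨k, T, c, hc, hT⟩ := hA
  refine ⟨_, fun E hE => finrank_le_of_disjoint_ker T.toLinearMap ?_⟩
  refine Submodule.disjoint_def.2 fun u hu (hTu : T u = 0) => ?_
  have : c * ‖u‖ ^ 2 ≤ 0 := by
    simpa [hTu] using (hT u).trans (add_le_add_left (hE u hu) _)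
  simpa using nonpos_of_mul_nonpos_right this hc

theorem CoerciveModFiniteRank.exists_maximal_negDefOn {A : H →L[𝕜] H}
    (hA : CoerciveModFiniteRank A) :
    ∃ E, NegDefOn A E ∧ ∀ E', NegDefOn A E' → Module.finrank 𝕜 E' ≤ Module.finrank 𝕜 E := by
  obtain ⟨k, hk⟩ := hA.exists_finrank_le
  let dims : Set ℕ := {d | ∃ E, NegDefOn A E ∧ Module.finrank 𝕜 E = d}
  have hne : dims.Nonempty := ⟨_, ⊥, fun u hu hu0 => (hu0 hu).elim, rfl⟩
  have hbdd : BddAbove dims := ⟨k, by rintro _ ⟨E, hE, rfl⟩; exact (hk E hE.nonposOn).2⟩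
  obtain ⟨E, hE, hEmax⟩ := Nat.sSup_mem hne hbdd
  exact ⟨E, hE, fun E' hE' => hEmax ▸ le_csSup hbdd ⟨E', hE', rfl⟩⟩

section Splitting

variable {A : H →L[𝕜] H} {E : Submodule 𝕜 H} [FiniteDimensional 𝕜 E]

theorem NegDefOn.nonneg_on_formOrthogonal (hE : NegDefOn A E)
    (hA : (A : H →ₗ[𝕜] H).IsSymmetric)
    (hmax : ∀ E', NegDefOn A E' → Module.finrank 𝕜 E' ≤ Module.finrank 𝕜 E) :
    ∀ y ∈ formOrthogonal A E, 0 ≤ A.reApplyInnerSelf y := by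
  intro y hy
  by_contra! hneg
  have hyE : y ∉ E := fun h => by
    simp [ContinuousLinearMap.reApplyInnerSelf_apply,
      inner_eq_zero_of_mem_formOrthogonal hy h] at hneg
  have hE' : NegDefOn A (E ⊔ 𝕜 ∙ y) := fun u hu hu0 => by
    obtain ⟨e, he, z, hz, rfl⟩ := Submodule.mem_sup.1 hu
    obtain ⟨c, rfl⟩ := Submodule.mem_span_singleton.1 hz
    have horth : inner 𝕜 (A e) (c • y) = 0 := by
      rw [hA.apply_clm, ← inner_conj_symm]
      simp [inner_smul_left, inner_eq_zero_of_mem_formOrthogonal hy he]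
    rw [reApplyInnerSelf_add_of_inner_eq_zero hA horth, ContinuousLinearMap.reApplyInnerSelf_smul]
    rcases eq_or_ne e 0 with rfl | he0
    · have hc0 : c ≠ 0 := by rintro rfl; simp at hu0
      simpa [ContinuousLinearMap.reApplyInnerSelf_apply A 0] using
        mul_neg_of_pos_of_neg (by positivity) hneg
    · exact add_neg_of_neg_of_nonpos (hE e he he0)
        (mul_nonpos_of_nonneg_of_nonpos (sq_nonneg _) hneg.le)
  have hlt : E < E ⊔ 𝕜 ∙ y := left_lt_sup.2 fun h =>
    hyE (h (Submodule.mem_span_singleton_self y))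
  exact (Submodule.finrank_lt_finrank_of_lt hlt).not_ge (hmax _ hE')

theorem NegDefOn.exists_sub_mem_formOrthogonal (hE : NegDefOn A E) (x : H) :
    ∃ e ∈ E, x - e ∈ formOrthogonal A E := by
  let π : H →ₗ[𝕜] E := E.orthogonalProjectionOnto.toLinearMap ∘ₗ (A : H →ₗ[𝕜] H)
  have hπ : ∀ y, π y = 0 ↔ y ∈ formOrthogonal A E := fun y =>
    Submodule.orthogonalProjectionOnto_eq_zero_iff
  have hinj : Function.Injective (π ∘ₗ E.subtype) := by
    refine (injective_iff_map_eq_zero _).2 fun e he => ?_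
    by_contra hne
    refine (hE e e.2 (by simpa using hne)).ne ?_
    rw [ContinuousLinearMap.reApplyInnerSelf_apply,
      inner_eq_zero_of_mem_formOrthogonal ((hπ e).1 he) e.2, map_zero]
  obtain ⟨e, he⟩ := LinearMap.injective_iff_surjective.1 hinj (π x)
  exact ⟨e, e.2, (hπ _).1 (by simpa [sub_eq_zero] using he.symm)⟩

theorem NegDefOn.pos_on_formOrthogonal_inf_ker_orthogonal (hE : NegDefOn A E)
    (hA : (A : H →ₗ[𝕜] H).IsSymmetric)
    (hmax : ∀ E', NegDefOn A E' → Module.finrank 𝕜 E' ≤ Module.finrank 𝕜 E) :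
    ∀ y ∈ formOrthogonal A E ⊓ A.kerᗮ, y ≠ 0 → 0 < A.reApplyInnerSelf y := by
  rintro y ⟨hyE, hyker⟩ hy0
  have hnonneg := hE.nonneg_on_formOrthogonal hA hmax
  refine lt_of_le_of_ne (hnonneg y hyE) fun hq => hy0 ?_
  have hAy : A y = 0 := by
    refine ext_inner_right 𝕜 fun x => ?_
    obtain ⟨e, he, hxe⟩ := hE.exists_sub_mem_formOrthogonal x
    have h0 : inner 𝕜 (A y) (x - e) = 0 := by
      simpa [← hq] using norm_inner_sq_le_of_nonneg_on hA hnonneg hyE hxe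
    rw [inner_zero_left, ← add_sub_cancel e x, inner_add_right,
      inner_eq_zero_of_mem_formOrthogonal hyE he, h0, add_zero]
  exact inner_self_eq_zero.1 (Submodule.inner_right_of_mem_orthogonal (K := A.ker) hAy hyker)

theorem finrank_le_add_finrank_ker_of_disjoint [FiniteDimensional 𝕜 A.ker] {F : Submodule 𝕜 H}
    (hF : Disjoint F (formOrthogonal A E ⊓ A.kerᗮ)) :
    Module.finrank 𝕜 F ≤ Module.finrank 𝕜 E + Module.finrank 𝕜 A.ker := by
  let π : H →ₗ[𝕜] E × A.ker := (E.orthogonalProjectionOnto.toLinearMap ∘ₗ (A : H →ₗ[𝕜] H)).prod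
    A.ker.orthogonalProjectionOnto.toLinearMap
  have hπ : π.ker = formOrthogonal A E ⊓ A.kerᗮ := by
    ext u
    simp [π, formOrthogonal, Submodule.orthogonalProjectionOnto_eq_zero_iff]
  simpa using (finrank_le_of_disjoint_ker π (hπ ▸ hF)).2

end Splitting

theorem CoerciveModFiniteRank.exists_negDefOn_eventually_finrank_le [CompleteSpace H]
    {A : H →L[𝕜] H} (hA : CoerciveModFiniteRank A) (hsymm : (A : H →ₗ[𝕜] H).IsSymmetric) :
    ∃ E : Submodule 𝕜 H, FiniteDimensional 𝕜 E ∧ NegDefOn A E ∧ ∀ᶠ B in 𝓝 A, ∀ F, NonposOn B F →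
      Module.finrank 𝕜 F ≤ Module.finrank 𝕜 E + Module.finrank 𝕜 A.ker := by
  obtain ⟨E, hE, hmax⟩ := hA.exists_maximal_negDefOn
  obtain ⟨k, hk⟩ := hA.exists_finrank_le
  have hEfin := (hk E hE.nonposOn).1
  have := (hk _ (nonposOn_ker A)).1
  obtain ⟨γ, hγ, hcoer⟩ := hA.exists_coercive_of_pos
    (Y := formOrthogonal A E ⊓ A.kerᗮ)
    ((isClosed_formOrthogonal A E).inter A.ker.isClosed_orthogonal)
    (hE.pos_on_formOrthogonal_inf_ker_orthogonal hsymm hmax)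
  refine ⟨E, hEfin, hE, ?_⟩
  filter_upwards [Metric.ball_mem_nhds A hγ] with B hB F hF
  refine finrank_le_add_finrank_ker_of_disjoint
    (Submodule.disjoint_def.2 fun u hu huY => ?_)
  rw [mem_ball_iff_norm', ← sub_pos] at hB
  have : (γ - ‖A - B‖) * ‖u‖ ^ 2 ≤ 0 := by
    linarith [hcoer u huY, reApplyInnerSelf_le_add_norm_sub A B u, hF u hu]
  simpa using nonpos_of_mul_nonpos_right this hB

/-- The parameters in `[a, b]` at which the form of `A l` is nonpositive on some subspace of
dimension at least `k`. Its infimum is where the `k`-th negative direction is born. -/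
def nonposParams (A : ℝ → H →L[𝕜] H) (a b : ℝ) (k : ℕ) : Set ℝ :=
  {l ∈ Icc a b | ∃ F : Submodule 𝕜 H, k ≤ Module.finrank 𝕜 F ∧ NonposOn (A l) F}

section Path

variable {A : ℝ → H →L[𝕜] H} {a b : ℝ} {k : ℕ}

theorem bddBelow_nonposParams : BddBelow (nonposParams A a b k) :=
  ⟨a, fun _ hl => hl.1.1⟩

theorem sInf_nonposParams_mem_Icc (hne : (nonposParams A a b k).Nonempty) :
    sInf (nonposParams A a b k) ∈ Icc a b := by
  obtain ⟨l, hl⟩ := hne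
  exact ⟨le_csInf ⟨l, hl⟩ fun _ hm => hm.1.1, (csInf_le bddBelow_nonposParams hl).trans hl.1.2⟩

theorem le_of_eventually_finrank_le (hA : Continuous A) (hne : (nonposParams A a b k).Nonempty)
    {d : ℕ} (hd : ∀ᶠ B in 𝓝 (A (sInf (nonposParams A a b k))), ∀ F, NonposOn B F →
      Module.finrank 𝕜 F ≤ d) : k ≤ d := by
  have hclosure := csInf_mem_closure hne bddBelow_nonposParams
  obtain ⟨l, hl, -, F, hkF, hF⟩ :=
    mem_closure_iff_nhds.1 hclosure _ ((hA.tendsto _).eventually hd)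
  exact hkF.trans (hl F hF)

theorem finrank_lt_of_negDefOn (hA : Continuous A)
    (ha : ∀ u, u ≠ 0 → 0 < (A a).reApplyInnerSelf u) (hk : 0 < k)
    (hne : (nonposParams A a b k).Nonempty) {E : Submodule 𝕜 H} [FiniteDimensional 𝕜 E]
    (hE : NegDefOn (A (sInf (nonposParams A a b k))) E) : Module.finrank 𝕜 E < k := by
  set l := sInf (nonposParams A a b k)
  by_contra! hkE
  have hl : l ∈ Icc a b := sInf_nonposParams_mem_Icc hne
  have hal : a < l := by
    refine lt_of_le_of_ne hl.1 fun hal => ?_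
    have := Module.nontrivial_of_finrank_pos (hk.trans_le hkE)
    obtain ⟨u, hu⟩ := exists_ne (0 : E)
    have hu0 : (u : H) ≠ 0 := by simpa using hu
    exact (hE u u.2 hu0).not_gt (hal ▸ ha u hu0)
  obtain ⟨m, hm, hml⟩ := Filter.nonempty_of_mem (inter_mem
    (mem_nhdsWithin_of_mem_nhds ((hA.tendsto l).eventually hE.eventually)) (Ioo_mem_nhdsLT hal))
  exact (csInf_le bddBelow_nonposParams
    ⟨⟨hml.1.le, hml.2.le.trans hl.2⟩, E, hkE, NegDefOn.nonposOn hm⟩).not_gt hml.2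

theorem exists_forall_mem_Ioc_finrank_ker [CompleteSpace H] (hA : Continuous A)
    (hsymm : ∀ l, (A l : H →ₗ[𝕜] H).IsSymmetric) (hcoer : ∀ l, CoerciveModFiniteRank (A l))
    (ha : ∀ u, u ≠ 0 → 0 < (A a).reApplyInnerSelf u) (l : ℝ) :
    ∃ d, ∀ k, 0 < k → (nonposParams A a b k).Nonempty → sInf (nonposParams A a b k) = l →
      k ∈ Finset.Ioc d (d + Module.finrank 𝕜 (A l).ker) := by
  obtain ⟨E, hEfin, hE, hd⟩ := (hcoer l).exists_negDefOn_eventually_finrank_le (hsymm l)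
  refine ⟨Module.finrank 𝕜 E, fun k hk hne hl => Finset.mem_Ioc.2 ⟨?_, ?_⟩⟩
  · exact finrank_lt_of_negDefOn hA ha hk hne (hl ▸ hE)
  · exact le_of_eventually_finrank_le hA hne (hl ▸ hd)

theorem exists_kernels_of_path [CompleteSpace H] (hA : Continuous A)
    (hsymm : ∀ l, (A l : H →ₗ[𝕜] H).IsSymmetric) (hcoer : ∀ l, CoerciveModFiniteRank (A l))
    (hab : a ≤ b) (ha : ∀ u, u ≠ 0 → 0 < (A a).reApplyInnerSelf u) {W : Submodule 𝕜 H}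
    (hW : NonposOn (A b) W) :
    ∃ ev : Fin (Module.finrank 𝕜 W) → ℝ, ∀ i,
      (Finset.univ.filter fun j => ev j = ev i).card ≤ Module.finrank 𝕜 (A (ev i)).ker := by
  refine ⟨fun i => sInf (nonposParams A a b (i + 1)), fun i => ?_⟩
  obtain ⟨d, hd⟩ := exists_forall_mem_Ioc_finrank_ker (b := b) hA hsymm hcoer ha
    (sInf (nonposParams A a b (i + 1)))
  dsimp only
  refine (Finset.card_le_card_of_injOn
    (t := Finset.Ioc d (d + Module.finrank 𝕜 (A (sInf (nonposParams A a b (i + 1)))).ker))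
    (fun j : Fin _ => (j : ℕ) + 1) (fun j hj => ?_)
    fun x _ y _ h => Fin.ext (by simpa using h)).trans_eq (by simp)
  exact hd _ j.val.succ_pos ⟨b, ⟨hab, le_rfl⟩, W, j.isLt, hW⟩ (Finset.mem_filter.1 hj).2

end Path

end QuadraticForms

/-! ### Differential operators and Hörmander's inequality -/

section Polynomials

variable {σ R : Type*} [CommSemiring R]

theorem totalDegree_pderiv_le (j : σ) (Q : MvPolynomial σ R) :
    (MvPolynomial.pderiv j Q).totalDegree ≤ Q.totalDegree - 1 := by
  refine Finset.sup_le fun β hβ => Nat.le_sub_one_of_lt ?_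
  rw [MvPolynomial.mem_support_iff, MvPolynomial.coeff_pderiv] at hβ
  have h := MvPolynomial.le_totalDegree (MvPolynomial.mem_support_iff.2 (left_ne_zero_of_mul hβ))
  change (β + Finsupp.single j 1).degree ≤ _ at h
  rw [map_add, Finsupp.degree_single] at h
  exact h

theorem iterate_pderiv_eq_zero (j : σ) {d : ℕ} {Q : MvPolynomial σ R} (hQ : Q.totalDegree ≤ d) :
    (MvPolynomial.pderiv j)^[d + 1] Q = 0 := by
  induction d generalizing Q with
  | zero =>
    rw [MvPolynomial.totalDegree_eq_zero_iff_eq_C.1 (Nat.le_zero.1 hQ)]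
    exact MvPolynomial.pderiv_C
  | succ d ih =>
    exact ih ((totalDegree_pderiv_le j Q).trans (Nat.sub_le_of_le_add hQ))

theorem pderiv_eq_zero_iff_notMem_vars [CharZero R] [NoZeroDivisors R] {j : σ}
    {Q : MvPolynomial σ R} : MvPolynomial.pderiv j Q = 0 ↔ j ∉ Q.vars := by
  refine ⟨fun h hj => ?_, MvPolynomial.pderiv_eq_zero_of_notMem_vars⟩
  obtain ⟨α, hα, hjα⟩ := (MvPolynomial.mem_vars_iff_mem_support j).1 hj
  have hle : Finsupp.single j 1 ≤ α :=
    Finsupp.single_le_iff.2 (Nat.one_le_iff_ne_zero.2 (Finsupp.mem_support_iff.1 hjα))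
  have hcoeff := congrArg (MvPolynomial.coeff (α - Finsupp.single j 1)) h
  rw [MvPolynomial.coeff_pderiv, tsub_add_cancel_of_le hle, MvPolynomial.coeff_zero] at hcoeff
  exact (MvPolynomial.mem_support_iff.1 hα)
    ((mul_eq_zero.1 hcoeff).resolve_right (Nat.cast_add_one_ne_zero _))

theorem exists_pderiv_ne_zero [CharZero R] [NoZeroDivisors R] {Q : MvPolynomial σ R}
    (hQ : Q.totalDegree ≠ 0) : ∃ j, MvPolynomial.pderiv j Q ≠ 0 := by
  by_contra! h
  refine hQ (MvPolynomial.totalDegree_eq_zero_iff_eq_C.2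
    (MvPolynomial.vars_eq_empty_iff_eq_C.1 ?_))
  exact Finset.eq_empty_of_forall_notMem fun j => pderiv_eq_zero_iff_notMem_vars.1 (h j)

/-- The substitution `Q(ξ) ↦ Q(ξ + t)`. -/
def shift (t : σ → R) : MvPolynomial σ R →ₐ[R] MvPolynomial σ R :=
  MvPolynomial.aeval fun k => MvPolynomial.X k + MvPolynomial.C (t k)

theorem shift_X (t : σ → R) (k : σ) :
    shift t (MvPolynomial.X k) = MvPolynomial.X k + MvPolynomial.C (t k) :=
  MvPolynomial.aeval_X _ _

theorem shift_C (t : σ → R) (c : R) : shift t (MvPolynomial.C c) = MvPolynomial.C c :=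
  MvPolynomial.aeval_C _ _

theorem shift_zero (Q : MvPolynomial σ R) : shift 0 Q = Q := by
  simp [shift]

theorem pderiv_shift (t : σ → R) (j : σ) (Q : MvPolynomial σ R) :
    MvPolynomial.pderiv j (shift t Q) = shift t (MvPolynomial.pderiv j Q) := by
  classical
  induction Q using MvPolynomial.induction_on with
  | C c => rw [shift_C, MvPolynomial.pderiv_C, map_zero]
  | add Q R hQ hR => simp only [map_add, hQ, hR]
  | mul_X Q k hQ =>
    have hX : MvPolynomial.pderiv j (shift t (MvPolynomial.X k)) =
        shift t (MvPolynomial.pderiv j (MvPolynomial.X k)) := by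
      rcases eq_or_ne k j with rfl | hkj
      · simp [shift_X]
      · simp [shift_X, MvPolynomial.pderiv_X_of_ne hkj]
    simp only [map_mul, MvPolynomial.pderiv_mul, map_add, hQ, hX]

theorem shift_single_of_pderiv_eq_C {K : Type*} [Field K] [CharZero K] [DecidableEq σ] {j : σ}
    {c : K} {Q : MvPolynomial σ K} (hQ : MvPolynomial.pderiv j Q = MvPolynomial.C c) (t : K) :
    shift (Pi.single j t) Q = Q + MvPolynomial.C (t * c) := by
  set Q₀ := Q - MvPolynomial.C c * MvPolynomial.X j with hQ₀
  have hj : j ∉ Q₀.vars := by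
    rw [← pderiv_eq_zero_iff_notMem_vars, hQ₀, map_sub, hQ, MvPolynomial.pderiv_C_mul,
      MvPolynomial.pderiv_X_self, mul_one, sub_self]
  have hfix : shift (Pi.single j t) Q₀ = Q₀ := by
    refine MvPolynomial.hom_congr_vars (f₁ := (shift (Pi.single j t)).toRingHom)
      (f₂ := RingHom.id _) (by ext; simp [shift]) (fun k hk _ => ?_) rfl
    have hkj : k ≠ j := fun h => hj (h ▸ hk)
    simp [shift_X, hkj]
  have hsplit : Q = Q₀ + MvPolynomial.C c * MvPolynomial.X j := (sub_add_cancel _ _).symm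
  rw [hsplit, map_add, map_mul, hfix, shift_C, shift_X, Pi.single_eq_same, mul_add, map_mul,
    mul_comm (MvPolynomial.C t), add_assoc]

theorem totalDegree_sub_C {A : Type*} [CommRing A] (P : MvPolynomial σ A) (c : A) :
    (P - MvPolynomial.C c).totalDegree = P.totalDegree := by
  refine le_antisymm (MvPolynomial.totalDegree_sub_C_le P c) ?_
  calc P.totalDegree = (P - MvPolynomial.C c - MvPolynomial.C (-c)).totalDegree := by
        congr 1
        rw [map_neg]
        ring
    _ ≤ _ := MvPolynomial.totalDegree_sub_C_le _ _

/-- A real polynomial with its coefficients regarded as complex numbers. -/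
abbrev toComplex : MvPolynomial σ ℝ →+* MvPolynomial σ ℂ :=
  MvPolynomial.map Complex.ofRealHom

/-- The polynomial with complex conjugate coefficients. -/
abbrev conjPoly : MvPolynomial σ ℂ →+* MvPolynomial σ ℂ :=
  MvPolynomial.map (starRingEnd ℂ)

theorem conjPoly_conjPoly (Q : MvPolynomial σ ℂ) : conjPoly (conjPoly Q) = Q := by
  rw [MvPolynomial.map_map]
  convert MvPolynomial.map_id Q
  ext
  simp

theorem conjPoly_toComplex (P : MvPolynomial σ ℝ) : conjPoly (toComplex P) = toComplex P := by
  rw [MvPolynomial.map_map]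
  congr 2
  ext x
  simp

end Polynomials

section Operators

variable {n : ℕ} {Ω : Opens (Space n)}

theorem add_testFunction_apply (φ ψ : 𝓓(Ω, ℂ)) (x : Space n) : (φ + ψ) x = φ x + ψ x := rfl

theorem smul_testFunction_apply (c : ℂ) (φ : 𝓓(Ω, ℂ)) (x : Space n) : (c • φ) x = c * φ x := rfl

theorem differentiable_testFunction (φ : 𝓓(Ω, ℂ)) : Differentiable ℝ φ :=
  φ.contDiff.differentiable (by simp)

theorem coeFn_testToL2 (φ : 𝓓(Ω, ℂ)) :
    testToL2 Ω φ =ᵐ[volume.restrict (Ω : Set (Space n))] φ :=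
  MemLp.coeFn_toLp (memLp_testFunction φ)

/-- Multiplication by a smooth function, acting on `C₀^∞(Ω)`. -/
def mulOp (Ω : Opens (Space n)) {a : Space n → ℂ} (ha : ContDiff ℝ (⊤ : ℕ∞) a) :
    Module.End ℂ 𝓓(Ω, ℂ) where
  toFun φ := ⟨fun x => a x * φ x, ha.mul φ.contDiff, φ.hasCompactSupport.mul_left,
    (closure_mono (Function.support_mul_subset_right a φ)).trans φ.tsupport_subset⟩
  map_add' _ _ := by
    ext x
    exact mul_add _ _ _
  map_smul' _ _ := by
    ext x
    exact mul_left_comm _ _ _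

theorem mulOp_apply {a : Space n → ℂ} (ha : ContDiff ℝ (⊤ : ℕ∞) a) (φ : 𝓓(Ω, ℂ)) (x : Space n) :
    mulOp Ω ha φ x = a x * φ x := rfl

theorem dOp_mulOp {a b : Space n → ℂ} (ha : ContDiff ℝ (⊤ : ℕ∞) a) (hb : ContDiff ℝ (⊤ : ℕ∞) b)
    {k : Fin n}
    (hab : ∀ x, b x = -Complex.I * fderiv ℝ a x (EuclideanSpace.single k (1 : ℝ)))
    (φ : 𝓓(Ω, ℂ)) :
    dOp Ω k (mulOp Ω ha φ) = mulOp Ω ha (dOp Ω k φ) + mulOp Ω hb φ := by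
  ext x
  have leibniz : fderiv ℝ (mulOp Ω ha φ) x = a x • fderiv ℝ φ x + φ x • fderiv ℝ a x :=
    fderiv_mul ((ha.differentiable (by simp)) x) (differentiable_testFunction φ x)
  rw [dOp_apply, leibniz, add_testFunction_apply, mulOp_apply, mulOp_apply, dOp_apply, hab]
  simp only [add_apply, smul_apply, smul_eq_mul]
  ring

theorem norm_mulOp_le {a : Space n → ℂ} (ha : ContDiff ℝ (⊤ : ℕ∞) a) {C : ℝ}
    (hC : ∀ x ∈ Ω, ‖a x‖ ≤ C) (φ : 𝓓(Ω, ℂ)) :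
    ‖testToL2 Ω (mulOp Ω ha φ)‖ ≤ C * ‖testToL2 Ω φ‖ := by
  refine Lp.norm_le_mul_norm_of_ae_le_mul ?_
  filter_upwards [coeFn_testToL2 (mulOp Ω ha φ), coeFn_testToL2 φ,
    ae_restrict_mem Ω.isOpen.measurableSet] with x h1 h2 hx
  rw [h1, h2, mulOp_apply, norm_mul]
  gcongr
  exact hC x hx

theorem dOp_dOp_apply (i j : Fin n) (φ : 𝓓(Ω, ℂ)) (x : Space n) :
    dOp Ω i (dOp Ω j φ) x = -(fderiv ℝ (fderiv ℝ φ) x (EuclideanSpace.single i (1 : ℝ))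
      (EuclideanSpace.single j (1 : ℝ))) := by
  have hd : DifferentiableAt ℝ (fderiv ℝ φ) x :=
    ((φ.contDiff.fderiv_right (m := 1) (WithTop.coe_le_coe.2 le_top)).differentiable (by simp)) x
  have hj : (dOp Ω j φ : Space n → ℂ) = fun y =>
      -Complex.I * fderiv ℝ φ y (EuclideanSpace.single j (1 : ℝ)) := funext (dOp_apply j φ)
  rw [dOp_apply, hj, fderiv_const_mul (hd.clm_apply (differentiableAt_const _)),
    fderiv_clm_apply hd (differentiableAt_const _)]
  simp only [smul_apply, add_apply, smul_eq_mul, ContinuousLinearMap.flip_apply,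
    ContinuousLinearMap.comp_apply, fderiv_const_apply, zero_apply, map_zero, zero_add]
  rw [← mul_assoc, neg_mul_neg, Complex.I_mul_I, neg_one_mul]

theorem dOp_comm (i j : Fin n) : dOp Ω i * dOp Ω j = dOp Ω j * dOp Ω i := by
  ext φ x
  have hs : IsSymmSndFDerivAt ℝ φ x :=
    φ.contDiff.contDiffAt.isSymmSndFDerivAt
      (by simpa using WithTop.coe_le_coe.2 (le_top (a := (2 : ℕ∞))))
  rw [Module.End.mul_apply, Module.End.mul_apply, dOp_dOp_apply, dOp_dOp_apply, hs]

/-- `Q(D)` for a complex polynomial `Q`, as a homomorphism of algebras in `Q`. It is defined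
through the commutative algebra generated by the `D_j`. -/
def diffOp (Ω : Opens (Space n)) : MvPolynomial (Fin n) ℂ →ₐ[ℂ] Module.End ℂ 𝓓(Ω, ℂ) :=
  have := Algebra.isMulCommutative_adjoin ℂ (s := range (dOp Ω)) (by
    rintro _ ⟨i, rfl⟩ _ ⟨j, rfl⟩; exact dOp_comm i j)
  letI : CommRing (Algebra.adjoin ℂ (range (dOp Ω))) :=
    { (Algebra.adjoin ℂ (range (dOp Ω))).toRing with mul_comm := mul_comm' }
  (Algebra.adjoin ℂ (range (dOp Ω))).val.comp
    (MvPolynomial.aeval fun j => ⟨dOp Ω j, Algebra.subset_adjoin (mem_range_self j)⟩)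

theorem diffOp_X (j : Fin n) : diffOp Ω (MvPolynomial.X j) = dOp Ω j := by
  simp [diffOp]

theorem diffOp_C (c : ℂ) (φ : 𝓓(Ω, ℂ)) : diffOp Ω (MvPolynomial.C c) φ = c • φ := by
  rw [← MvPolynomial.algebraMap_eq, AlgHom.commutes]
  rfl

theorem diffOp_mul_apply (Q R : MvPolynomial (Fin n) ℂ) (φ : 𝓓(Ω, ℂ)) :
    diffOp Ω (Q * R) φ = diffOp Ω Q (diffOp Ω R φ) := by
  rw [map_mul, Module.End.mul_apply]

theorem polyOp_eq_diffOp (P : MvPolynomial (Fin n) ℝ) : polyOp P Ω = diffOp Ω (toComplex P) := by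
  conv_rhs => rw [P.as_sum]
  rw [polyOp, map_sum, map_sum]
  refine Finset.sum_congr rfl fun α _ => ?_
  have hmono : (MvPolynomial.monomial α (Complex.ofRealHom (P.coeff α)) :
      MvPolynomial (Fin n) ℂ) = ((P.coeff α : ℝ) : ℂ) •
        (List.ofFn fun j => (MvPolynomial.X j : MvPolynomial (Fin n) ℂ) ^ α j).prod := by
    rw [List.prod_ofFn, MvPolynomial.monomial_eq, MvPolynomial.smul_eq_C_mul,
      Finsupp.prod_fintype _ _ (by simp)]
    rfl
  rw [MvPolynomial.map_monomial, hmono, map_smul, map_list_prod, List.map_ofFn, dPow]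
  simp only [Function.comp_def, map_pow, diffOp_X]

theorem polyOp_sub_C (P : MvPolynomial (Fin n) ℝ) (l : ℝ) (φ : 𝓓(Ω, ℂ)) :
    polyOp (P - MvPolynomial.C l) Ω φ = polyOp P Ω φ - (l : ℂ) • φ := by
  rw [polyOp_eq_diffOp, polyOp_eq_diffOp, map_sub, map_sub, LinearMap.sub_apply,
    MvPolynomial.map_C, diffOp_C]
  rfl

theorem inner_diffOp (Q : MvPolynomial (Fin n) ℂ) (φ ψ : 𝓓(Ω, ℂ)) :
    inner ℂ (testToL2 Ω φ) (testToL2 Ω (diffOp Ω Q ψ)) =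
      inner ℂ (testToL2 Ω (diffOp Ω (conjPoly Q) φ)) (testToL2 Ω ψ) := by
  induction Q using MvPolynomial.induction_on generalizing φ ψ with
  | C c =>
    rw [MvPolynomial.map_C, diffOp_C, diffOp_C, map_smul, map_smul, inner_smul_left,
      inner_smul_right, Complex.conj_conj]
  | add Q R hQ hR =>
    simp only [map_add, LinearMap.add_apply, inner_add_left, inner_add_right, hQ, hR]
  | mul_X Q j hQ =>
    rw [diffOp_mul_apply, hQ, diffOp_X, dOp_symm, map_mul, MvPolynomial.map_X, mul_comm,
      diffOp_mul_apply, diffOp_X]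

theorem inner_diffOp_diffOp (Q R : MvPolynomial (Fin n) ℂ) (φ ψ : 𝓓(Ω, ℂ)) :
    inner ℂ (testToL2 Ω (diffOp Ω Q φ)) (testToL2 Ω (diffOp Ω R ψ)) =
      inner ℂ (testToL2 Ω (diffOp Ω (conjPoly R) φ)) (testToL2 Ω (diffOp Ω (conjPoly Q) ψ)) := by
  rw [inner_diffOp, inner_diffOp, conjPoly_conjPoly, ← diffOp_mul_apply, ← diffOp_mul_apply,
    mul_comm]

theorem norm_diffOp_conjPoly (Q : MvPolynomial (Fin n) ℂ) (φ : 𝓓(Ω, ℂ)) :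
    ‖testToL2 Ω (diffOp Ω (conjPoly Q) φ)‖ = ‖testToL2 Ω (diffOp Ω Q φ)‖ := by
  rw [norm_eq_sqrt_re_inner (𝕜 := ℂ), norm_eq_sqrt_re_inner (𝕜 := ℂ), inner_diffOp_diffOp Q Q]

theorem im_inner_diffOp_toComplex (P : MvPolynomial (Fin n) ℝ) (φ : 𝓓(Ω, ℂ)) :
    (inner ℂ (testToL2 Ω (diffOp Ω (toComplex P) φ)) (testToL2 Ω φ)).im = 0 := by
  rw [← Complex.conj_eq_iff_im, inner_conj_symm, inner_diffOp, conjPoly_toComplex]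

theorem contDiff_coord (j : Fin n) : ContDiff ℝ (⊤ : ℕ∞) fun x : Space n => ((x j : ℝ) : ℂ) :=
  Complex.ofRealCLM.contDiff.comp (EuclideanSpace.proj (𝕜 := ℝ) j).contDiff

theorem fderiv_coord (j k : Fin n) (x : Space n) :
    fderiv ℝ (fun x : Space n => ((x j : ℝ) : ℂ)) x (EuclideanSpace.single k (1 : ℝ)) =
      if j = k then 1 else 0 := by
  have h : HasFDerivAt (fun x : Space n => ((x j : ℝ) : ℂ))
      (Complex.ofRealCLM.comp (EuclideanSpace.proj (𝕜 := ℝ) j)) x :=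
    (Complex.ofRealCLM.comp (EuclideanSpace.proj (𝕜 := ℝ) j)).hasFDerivAt
  rw [h.fderiv]
  by_cases hjk : j = k <;> simp [hjk]

/-- Multiplication by the coordinate `x_j`. -/
def coordOp (Ω : Opens (Space n)) (j : Fin n) : Module.End ℂ 𝓓(Ω, ℂ) := mulOp Ω (contDiff_coord j)

theorem norm_coordOp_le {A : ℝ} (hA : ∀ x ∈ Ω, ‖x‖ ≤ A) (j : Fin n) (φ : 𝓓(Ω, ℂ)) :
    ‖testToL2 Ω (coordOp Ω j φ)‖ ≤ A * ‖testToL2 Ω φ‖ :=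
  norm_mulOp_le _ (fun x hx => by
    rw [Complex.norm_real]; exact (PiLp.norm_apply_le x j).trans (hA x hx)) φ

theorem dOp_coordOp (j k : Fin n) (φ : 𝓓(Ω, ℂ)) :
    dOp Ω k (coordOp Ω j φ) = coordOp Ω j (dOp Ω k φ) +
      (-Complex.I * if j = k then 1 else 0) • φ :=
  dOp_mulOp (contDiff_coord j) (contDiff_const (c := -Complex.I * if j = k then 1 else 0))
    (fun x => by rw [fderiv_coord]) φ

theorem diffOp_coordOp (j : Fin n) (Q : MvPolynomial (Fin n) ℂ) (φ : 𝓓(Ω, ℂ)) :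
    diffOp Ω Q (coordOp Ω j φ) = coordOp Ω j (diffOp Ω Q φ) +
      (-Complex.I) • diffOp Ω (MvPolynomial.pderiv j Q) φ := by
  induction Q using MvPolynomial.induction_on generalizing φ with
  | C c => simp
  | add Q R hQ hR =>
    simp only [map_add, LinearMap.add_apply, hQ, hR, smul_add]
    abel
  | mul_X Q k hQ =>
    rw [diffOp_mul_apply, diffOp_X, dOp_coordOp, map_add, hQ, map_smul, diffOp_mul_apply,
      diffOp_X, MvPolynomial.pderiv_mul, map_add, LinearMap.add_apply, diffOp_mul_apply, diffOp_X]
    rcases eq_or_ne j k with rfl | hjk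
    · simp [add_assoc]
    · simp [hjk, MvPolynomial.pderiv_X_of_ne hjk.symm]

theorem diffOp_pderiv (j : Fin n) (Q : MvPolynomial (Fin n) ℂ) (φ : 𝓓(Ω, ℂ)) :
    diffOp Ω (MvPolynomial.pderiv j Q) φ =
      Complex.I • (diffOp Ω Q (coordOp Ω j φ) - coordOp Ω j (diffOp Ω Q φ)) := by
  rw [diffOp_coordOp, add_sub_cancel_left, smul_smul, mul_neg, Complex.I_mul_I, neg_neg, one_smul]

theorem norm_diffOp_coordOp_le {A : ℝ} (hA : ∀ x ∈ Ω, ‖x‖ ≤ A) (j : Fin n)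
    (Q : MvPolynomial (Fin n) ℂ) (φ : 𝓓(Ω, ℂ)) :
    ‖testToL2 Ω (diffOp Ω Q (coordOp Ω j φ))‖ ≤
      A * ‖testToL2 Ω (diffOp Ω Q φ)‖ + ‖testToL2 Ω (diffOp Ω (MvPolynomial.pderiv j Q) φ)‖ := by
  rw [diffOp_coordOp, map_add, map_smul]
  refine (norm_add_le _ _).trans (add_le_add (norm_coordOp_le hA j _) ?_)
  rw [norm_smul, norm_neg, Complex.norm_I, one_mul]

theorem norm_sq_diffOp_pderiv_le {A : ℝ} (hA : ∀ x ∈ Ω, ‖x‖ ≤ A) (j : Fin n)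
    (Q : MvPolynomial (Fin n) ℂ) (φ : 𝓓(Ω, ℂ)) :
    ‖testToL2 Ω (diffOp Ω (MvPolynomial.pderiv j Q) φ)‖ ^ 2 ≤
      ‖testToL2 Ω (diffOp Ω Q φ)‖ *
        (2 * A * ‖testToL2 Ω (diffOp Ω (MvPolynomial.pderiv j Q) φ)‖ +
          ‖testToL2 Ω (diffOp Ω (MvPolynomial.pderiv j (MvPolynomial.pderiv j Q)) φ)‖) := by
  set Q' := MvPolynomial.pderiv j Q with hQ'
  set f := testToL2 Ω (diffOp Ω Q' φ) with hf
  have hsq : ‖f‖ ^ 2 = ‖inner ℂ f (testToL2 Ω (diffOp Ω Q (coordOp Ω j φ))) -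
      inner ℂ f (testToL2 Ω (coordOp Ω j (diffOp Ω Q φ)))‖ := by
    rw [← inner_sub_right, ← map_sub, ← one_mul ‖inner ℂ f _‖, ← Complex.norm_I, ← norm_mul,
      ← inner_smul_right, ← map_smul, ← diffOp_pderiv, ← hQ', ← hf, inner_self_eq_norm_sq_to_K]
    simp
  -- Moving `Q(D)` to the other side replaces it by `Q'(D)` acting on `x_j φ`.
  have hfirst : ‖inner ℂ f (testToL2 Ω (diffOp Ω Q (coordOp Ω j φ)))‖ ≤
      ‖testToL2 Ω (diffOp Ω Q φ)‖ *
        (A * ‖f‖ + ‖testToL2 Ω (diffOp Ω (MvPolynomial.pderiv j Q') φ)‖) := by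
    rw [inner_diffOp_diffOp]
    refine (norm_inner_le_norm _ _).trans ?_
    rw [norm_diffOp_conjPoly, norm_diffOp_conjPoly]
    gcongr
    exact norm_diffOp_coordOp_le hA j Q' φ
  have hsecond : ‖inner ℂ f (testToL2 Ω (coordOp Ω j (diffOp Ω Q φ)))‖ ≤
      ‖f‖ * (A * ‖testToL2 Ω (diffOp Ω Q φ)‖) :=
    (norm_inner_le_norm _ _).trans (by gcongr; exact norm_coordOp_le hA j _)
  rw [hsq]
  linarith [norm_sub_le (inner ℂ f (testToL2 Ω (diffOp Ω Q (coordOp Ω j φ))))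
    (inner ℂ f (testToL2 Ω (coordOp Ω j (diffOp Ω Q φ))))]

/-- Hörmander's inequality `‖(∂_j Q)(D) φ‖ ≤ C ‖Q(D) φ‖` on a bounded set, with a constant that
depends on `Q` only through its order in `ξ_j`. -/
theorem norm_diffOp_pderiv_le {A : ℝ} (hA0 : 0 ≤ A) (hA : ∀ x ∈ Ω, ‖x‖ ≤ A) (j : Fin n)
    {d : ℕ} {Q : MvPolynomial (Fin n) ℂ} (hQ : (MvPolynomial.pderiv j)^[d + 1] Q = 0)
    (φ : 𝓓(Ω, ℂ)) :
    ‖testToL2 Ω (diffOp Ω (MvPolynomial.pderiv j Q) φ)‖ ≤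
      2 * d * A * ‖testToL2 Ω (diffOp Ω Q φ)‖ := by
  induction d generalizing Q with
  | zero => simp [show MvPolynomial.pderiv j Q = 0 from hQ]
  | succ d ih =>
    rcases (norm_nonneg (testToL2 Ω (diffOp Ω (MvPolynomial.pderiv j Q) φ))).eq_or_lt with h | h
    · rw [← h]
      positivity
    · refine le_of_mul_le_mul_left ?_ h
      calc _ ≤ _ := (sq _).symm.trans_le (norm_sq_diffOp_pderiv_le hA j Q φ)
        _ ≤ ‖testToL2 Ω (diffOp Ω Q φ)‖ *
            (2 * A * ‖testToL2 Ω (diffOp Ω (MvPolynomial.pderiv j Q) φ)‖ +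
              2 * d * A * ‖testToL2 Ω (diffOp Ω (MvPolynomial.pderiv j Q) φ)‖) := by
          gcongr
          exact ih hQ
        _ = _ := by push_cast; ring

end Operators

/-! ### Unique continuation -/

section UniqueContinuation

variable {n : ℕ} {Ω : Opens (Space n)}

/-- `‖R(D + t) φ‖ ≤ C ‖Q(D + t) φ‖` for `φ ∈ C₀^∞(Ω)` and all `t`, with one constant `C`. The
uniformity in `t` is what allows conjugation by exponential weights. -/
def Dominates (Ω : Opens (Space n)) (Q R : MvPolynomial (Fin n) ℂ) : Prop :=
  ∃ C : ℝ, 0 ≤ C ∧ ∀ t (φ : 𝓓(Ω, ℂ)), ‖testToL2 Ω (diffOp Ω (shift t R) φ)‖ ≤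
    C * ‖testToL2 Ω (diffOp Ω (shift t Q) φ)‖

theorem Dominates.refl (Q : MvPolynomial (Fin n) ℂ) : Dominates Ω Q Q :=
  ⟨1, zero_le_one, fun t φ => by rw [one_mul]⟩

theorem Dominates.trans {Q R S : MvPolynomial (Fin n) ℂ} (hQR : Dominates Ω Q R)
    (hRS : Dominates Ω R S) : Dominates Ω Q S := by
  obtain ⟨C, hC, h⟩ := hQR
  obtain ⟨C', hC', h'⟩ := hRS
  refine ⟨C' * C, by positivity, fun t φ => (h' t φ).trans ?_⟩
  rw [mul_assoc]
  gcongr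
  exact h t φ

theorem Dominates.exists_norm_le {Q R : MvPolynomial (Fin n) ℂ} (h : Dominates Ω Q R) :
    ∃ C : ℝ, ∀ φ : 𝓓(Ω, ℂ),
      ‖testToL2 Ω (diffOp Ω R φ)‖ ≤ C * ‖testToL2 Ω (diffOp Ω Q φ)‖ := by
  obtain ⟨C, -, h⟩ := h
  exact ⟨C, fun φ => by simpa only [shift_zero] using h 0 φ⟩

theorem dominates_pderiv (hΩ : Bornology.IsBounded (Ω : Set (Space n))) (j : Fin n)
    (Q : MvPolynomial (Fin n) ℂ) : Dominates Ω Q (MvPolynomial.pderiv j Q) := by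
  obtain ⟨A, hA0, hA⟩ := hΩ.exists_pos_norm_le
  refine ⟨2 * Q.totalDegree * A, by positivity, fun t φ => ?_⟩
  rw [← pderiv_shift]
  refine norm_diffOp_pderiv_le hA0.le hA j ?_ φ
  have hcomm : Function.Commute (MvPolynomial.pderiv j) (shift t : MvPolynomial (Fin n) ℂ → _) :=
    pderiv_shift t j
  rw [hcomm.iterate_left, iterate_pderiv_eq_zero j le_rfl, map_zero]

theorem exists_dominated_of_pderiv_eq_C (hΩ : Bornology.IsBounded (Ω : Set (Space n)))
    {P : MvPolynomial (Fin n) ℝ} (hP : P.totalDegree ≠ 0) :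
    ∃ (R : MvPolynomial (Fin n) ℝ) (j : Fin n) (c : ℝ), c ≠ 0 ∧
      MvPolynomial.pderiv j R = MvPolynomial.C c ∧ Dominates Ω (toComplex P) (toComplex R) := by
  induction hd : P.totalDegree using Nat.strong_induction_on generalizing P with
  | _ d ih =>
    obtain ⟨j, hj⟩ := exists_pderiv_ne_zero hP
    by_cases h0 : (MvPolynomial.pderiv j P).totalDegree = 0
    · have hC := MvPolynomial.totalDegree_eq_zero_iff_eq_C.1 h0
      exact ⟨P, j, _, fun hc => hj (by rw [hC, hc, map_zero]), hC, Dominates.refl _⟩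
    · obtain ⟨R, k, c, hc, hR, hdom⟩ := ih _ (by have := totalDegree_pderiv_le j P; omega) h0 rfl
      refine ⟨R, k, c, hc, hR, Dominates.trans ?_ hdom⟩
      simpa only [MvPolynomial.pderiv_map] using dominates_pderiv hΩ j (toComplex P)

/-- The exponential weight `e^{τ x_j}`. -/
def weight (j : Fin n) (τ : ℝ) (x : Space n) : ℂ := Complex.exp (τ * (x j : ℝ))

theorem contDiff_weight (j : Fin n) (τ : ℝ) : ContDiff ℝ (⊤ : ℕ∞) (weight j τ : Space n → ℂ) :=
  Complex.contDiff_exp.comp (contDiff_const.mul (contDiff_coord j))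

theorem fderiv_weight (j k : Fin n) (τ : ℝ) (x : Space n) :
    fderiv ℝ (weight j τ) x (EuclideanSpace.single k (1 : ℝ)) =
      if j = k then τ * weight j τ x else 0 := by
  have hd : DifferentiableAt ℝ (fun x : Space n => ((x j : ℝ) : ℂ)) x :=
    ((contDiff_coord j).differentiable (by simp)) x
  have h : HasFDerivAt (weight j τ)
      (weight j τ x • ((τ : ℂ) • fderiv ℝ (fun x : Space n => ((x j : ℝ) : ℂ)) x)) x :=
    (hd.hasFDerivAt.const_mul (τ : ℂ)).cexp
  rw [h.fderiv, smul_apply, smul_apply, fderiv_coord]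
  split_ifs <;> simp [mul_comm]

theorem dOp_weight (j k : Fin n) (τ : ℝ) (φ : 𝓓(Ω, ℂ)) :
    dOp Ω k (mulOp Ω (contDiff_weight j τ) φ) = mulOp Ω (contDiff_weight j τ) (dOp Ω k φ) -
      (if j = k then Complex.I * τ else 0) • mulOp Ω (contDiff_weight j τ) φ := by
  rw [dOp_mulOp (contDiff_weight j τ)
    ((contDiff_const (c := if j = k then -Complex.I * τ else 0)).mul (contDiff_weight j τ))
    (fun x => by rw [fderiv_weight]; split_ifs <;> ring), sub_eq_add_neg, ← neg_smul]
  congr 1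
  ext x
  rw [smul_testFunction_apply, mulOp_apply, mulOp_apply]
  split_ifs <;> ring

theorem weight_diffOp (j : Fin n) (τ : ℝ) (Q : MvPolynomial (Fin n) ℂ) (φ : 𝓓(Ω, ℂ)) :
    mulOp Ω (contDiff_weight j τ) (diffOp Ω Q φ) =
      diffOp Ω (shift (Pi.single j (Complex.I * τ)) Q) (mulOp Ω (contDiff_weight j τ) φ) := by
  induction Q using MvPolynomial.induction_on generalizing φ with
  | C c => simp [shift]
  | add Q R hQ hR => simp only [map_add, LinearMap.add_apply, hQ, hR]
  | mul_X Q k hQ =>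
    have hX : shift (Pi.single j (Complex.I * τ)) (MvPolynomial.X k) =
        MvPolynomial.X k + MvPolynomial.C (if j = k then Complex.I * τ else 0) := by
      simp [shift_X, Pi.single_apply, eq_comm]
    rw [diffOp_mul_apply, hQ, map_mul, diffOp_mul_apply, hX, map_add, LinearMap.add_apply,
      diffOp_X, diffOp_C, dOp_weight, sub_add_cancel]

theorem abs_mul_norm_le_norm_add_I_smul {E : Type*} [NormedAddCommGroup E]
    [InnerProductSpace ℂ E] {f g : E} (h : (inner ℂ f g : ℂ).im = 0) (s : ℝ) :
    |s| * ‖g‖ ≤ ‖f + (Complex.I * s) • g‖ := by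
  refine le_of_sq_le_sq ?_ (norm_nonneg _)
  have horth : RCLike.re (inner ℂ f ((Complex.I * s) • g)) = 0 := by
    simp [h]
  rw [norm_add_sq (𝕜 := ℂ), horth, norm_smul]
  simp

/-- A Carleman estimate with linear weights. -/
theorem exists_weighted_estimate (hΩ : Bornology.IsBounded (Ω : Set (Space n)))
    {P : MvPolynomial (Fin n) ℝ} (hP : P.totalDegree ≠ 0) :
    ∃ (j : Fin n) (c : ℝ), 0 < c ∧ ∀ (τ : ℝ) (φ : 𝓓(Ω, ℂ)),
      c * |τ| * ‖testToL2 Ω (mulOp Ω (contDiff_weight j τ) φ)‖ ≤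
        ‖testToL2 Ω (mulOp Ω (contDiff_weight j τ) (polyOp P Ω φ))‖ := by
  obtain ⟨R, j, c, hc, hR, C, hC, hdom⟩ := exists_dominated_of_pderiv_eq_C hΩ hP
  have hRC : MvPolynomial.pderiv j (toComplex R) = MvPolynomial.C (c : ℂ) := by
    rw [MvPolynomial.pderiv_map, hR, MvPolynomial.map_C]
    rfl
  refine ⟨j, |c| / (C + 1), div_pos (abs_pos.2 hc) (by positivity), fun τ φ => ?_⟩
  rw [polyOp_eq_diffOp, weight_diffOp]
  set ψ := mulOp Ω (contDiff_weight j τ) φ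
  set b := ‖testToL2 Ω (diffOp Ω (shift (Pi.single j (Complex.I * τ)) (toComplex P)) ψ)‖
  have hψ : |τ * c| * ‖testToL2 Ω ψ‖ ≤ C * b := by
    refine (abs_mul_norm_le_norm_add_I_smul (im_inner_diffOp_toComplex R ψ) (τ * c)).trans ?_
    have h := hdom (Pi.single j (Complex.I * τ)) ψ
    rwa [shift_single_of_pderiv_eq_C hRC, map_add, LinearMap.add_apply, diffOp_C, map_add,
      map_smul, mul_assoc, ← Complex.ofReal_mul] at h
  rw [abs_mul] at hψ
  rw [div_mul_eq_mul_div, div_mul_eq_mul_div, div_le_iff₀ (by positivity)]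
  linarith [show 0 ≤ b from norm_nonneg _]

/-- Multiplication by an essentially bounded function, acting on `L²(Ω)`. -/
def mulL2 {g : Space n → ℂ} (hg : MemLp g ⊤ (volume.restrict (Ω : Set (Space n)))) :
    L2 Ω →L[ℂ] L2 Ω :=
  (ContinuousLinearMap.mul ℂ ℂ).holderL (volume.restrict (Ω : Set (Space n))) ⊤ 2 2 hg.toLp

theorem coeFn_mulL2 {g : Space n → ℂ} (hg : MemLp g ⊤ (volume.restrict (Ω : Set (Space n))))
    (f : L2 Ω) : mulL2 hg f =ᵐ[volume.restrict (Ω : Set (Space n))] fun x => g x * f x := by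
  filter_upwards [(ContinuousLinearMap.mul ℂ ℂ).coeFn_holder (r := 2) (hg.toLp) f, hg.coeFn_toLp]
    with x h1 h2
  rw [← h2]
  exact h1

theorem testToL2_mulOp {a : Space n → ℂ} (ha : ContDiff ℝ (⊤ : ℕ∞) a)
    (ha' : MemLp a ⊤ (volume.restrict (Ω : Set (Space n)))) (φ : 𝓓(Ω, ℂ)) :
    testToL2 Ω (mulOp Ω ha φ) = mulL2 ha' (testToL2 Ω φ) := by
  refine Lp.ext ?_
  filter_upwards [coeFn_testToL2 (mulOp Ω ha φ), coeFn_testToL2 φ,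
    coeFn_mulL2 ha' (testToL2 Ω φ)] with x h1 h2 h3
  rw [h1, h3, h2, mulOp_apply]

theorem injective_mulL2 {g : Space n → ℂ}
    (hg : MemLp g ⊤ (volume.restrict (Ω : Set (Space n))))
    (hg0 : ∀ᵐ x ∂(volume.restrict (Ω : Set (Space n))), g x ≠ 0) :
    Function.Injective (mulL2 hg) := by
  refine (injective_iff_map_eq_zero _).2 fun f hf => Lp.eq_zero_iff_ae_eq_zero.2 ?_
  filter_upwards [coeFn_mulL2 hg f, Lp.eq_zero_iff_ae_eq_zero.1 hf, hg0] with x h1 h2 h3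
  exact (mul_eq_zero.1 (h1.symm.trans h2)).resolve_left h3

theorem norm_mulL2_le_mul_norm_mulL2 {g : Space n → ℂ}
    (hg : MemLp g ⊤ (volume.restrict (Ω : Set (Space n)))) {f h : L2 Ω} {M : ℝ}
    (hM : ∀ᵐ x ∂(volume.restrict (Ω : Set (Space n))), ‖f x‖ ≤ M * ‖h x‖) :
    ‖mulL2 hg f‖ ≤ M * ‖mulL2 hg h‖ := by
  refine Lp.norm_le_mul_norm_of_ae_le_mul ?_
  filter_upwards [coeFn_mulL2 hg f, coeFn_mulL2 hg h, hM] with x h1 h2 h3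
  rw [h1, h2, norm_mul, norm_mul, mul_left_comm]
  gcongr

theorem memLp_top_weight (hΩ : Bornology.IsBounded (Ω : Set (Space n))) (j : Fin n) (τ : ℝ) :
    MemLp (weight j τ) ⊤ (volume.restrict (Ω : Set (Space n))) := by
  obtain ⟨A, -, hA⟩ := hΩ.exists_pos_norm_le
  refine memLp_top_of_bound (contDiff_weight j τ).continuous.aestronglyMeasurable
    (Real.exp (|τ| * A)) ?_
  filter_upwards [ae_restrict_mem Ω.isOpen.measurableSet] with x hx
  rw [weight, Complex.norm_exp, ← Complex.ofReal_mul, Complex.ofReal_re, Real.exp_le_exp]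
  calc τ * x j ≤ |τ * x j| := le_abs_self _
    _ = |τ| * ‖x j‖ := abs_mul _ _
    _ ≤ |τ| * A := by gcongr; exact (PiLp.norm_apply_le x j).trans (hA x hx)

theorem minGraph_subset_of_isClosed {P : MvPolynomial (Fin n) ℝ} {S : Set (L2 Ω × L2 Ω)}
    (hS : IsClosed S) (h : ∀ φ, (testToL2 Ω φ, testToL2 Ω (polyOp P Ω φ)) ∈ S) :
    (minGraph P Ω : Set (L2 Ω × L2 Ω)) ⊆ S :=
  closure_minimal (by rintro _ ⟨φ, rfl⟩; exact h φ) hS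

theorem exists_weighted_estimate_minGraph (hΩ : Bornology.IsBounded (Ω : Set (Space n)))
    {P : MvPolynomial (Fin n) ℝ} (hP : P.totalDegree ≠ 0) (l : ℝ) :
    ∃ (j : Fin n) (c : ℝ), 0 < c ∧ ∀ τ : ℝ, ∀ z ∈ minGraph P Ω,
      c * |τ| * ‖mulL2 (memLp_top_weight hΩ j τ) z.1‖ ≤
        ‖mulL2 (memLp_top_weight hΩ j τ) (z.2 - (l : ℂ) • z.1)‖ := by
  obtain ⟨j, c, hc, hest⟩ := exists_weighted_estimate hΩ ((totalDegree_sub_C P l).trans_ne hP)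
  refine ⟨j, c, hc, fun τ z hz => ?_⟩
  have hw := memLp_top_weight hΩ j τ
  refine minGraph_subset_of_isClosed (S := {z : L2 Ω × L2 Ω |
    c * |τ| * ‖mulL2 hw z.1‖ ≤ ‖mulL2 hw (z.2 - (l : ℂ) • z.1)‖})
    (isClosed_le (by fun_prop) (by fun_prop)) (fun φ => ?_) hz
  have h := hest τ φ
  rwa [polyOp_sub_C, testToL2_mulOp _ hw, testToL2_mulOp _ hw, map_sub, map_smul] at h

/-- Unique continuation for the differential inequality `|(P(D) - l) u| ≤ M |u|` in
`H₀^P(Ω)`: in the Carleman estimate the weight can be chosen large compared with `M`. -/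
theorem eq_zero_of_mem_minGraph_of_norm_le (hΩ : Bornology.IsBounded (Ω : Set (Space n)))
    {P : MvPolynomial (Fin n) ℝ} (hP : P.totalDegree ≠ 0) {z : L2 Ω × L2 Ω}
    (hz : z ∈ minGraph P Ω) (l M : ℝ)
    (hM : ∀ᵐ x ∂(volume.restrict (Ω : Set (Space n))), ‖(z.2 - (l : ℂ) • z.1) x‖ ≤ M * ‖z.1 x‖) :
    z.1 = 0 := by
  obtain ⟨j, c, hc, hest⟩ := exists_weighted_estimate_minGraph hΩ hP l
  set τ : ℝ := (|M| + 1) / c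
  have hτ : c * |τ| = |M| + 1 := by
    rw [abs_of_pos (by positivity)]
    exact mul_div_cancel₀ _ hc.ne'
  set w := mulL2 (memLp_top_weight hΩ j τ)
  have hle : (|M| + 1) * ‖w z.1‖ ≤ M * ‖w z.1‖ :=
    hτ ▸ (hest τ z hz).trans (norm_mulL2_le_mul_norm_mulL2 _ hM)
  have hw : w z.1 = 0 := by
    rw [← norm_le_zero_iff]
    nlinarith [le_abs_self M, norm_nonneg (w z.1)]
  exact injective_mulL2 _ (.of_forall fun x => Complex.exp_ne_zero _) (hw.trans (map_zero _).symm)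

end UniqueContinuation

/-! ### Compactness of the embedding -/

section FiniteRank

variable {𝕜 H : Type*} [RCLike 𝕜] [NormedAddCommGroup H] [InnerProductSpace 𝕜 H]

theorem norm_sq_sqrt_smul_apply {F : Type*} [NormedAddCommGroup F] [NormedSpace 𝕜 F]
    (T : H →L[𝕜] F) {c : ℝ} (hc : 0 ≤ c) (u : H) :
    ‖((Real.sqrt c : 𝕜) • T) u‖ ^ 2 = c * ‖T u‖ ^ 2 := by
  rw [smul_apply, norm_smul, mul_pow, RCLike.norm_ofReal, sq_abs, Real.sq_sqrt hc]

theorem norm_inner_sq_le_of_mem_ball {x y : H} {r : ℝ} (h : x ∈ Metric.ball y r) (u : H) :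
    ‖(inner 𝕜 x u : 𝕜)‖ ^ 2 ≤ 2 * r ^ 2 * ‖u‖ ^ 2 + 2 * ‖(inner 𝕜 y u : 𝕜)‖ ^ 2 := by
  have htri : ‖(inner 𝕜 x u : 𝕜)‖ ≤ r * ‖u‖ + ‖(inner 𝕜 y u : 𝕜)‖ :=
    calc ‖(inner 𝕜 x u : 𝕜)‖ = ‖(inner 𝕜 (x - y) u : 𝕜) + inner 𝕜 y u‖ := by
          rw [inner_sub_left, sub_add_cancel]
      _ ≤ ‖(inner 𝕜 (x - y) u : 𝕜)‖ + ‖(inner 𝕜 y u : 𝕜)‖ := norm_add_le _ _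
      _ ≤ _ := by
          gcongr
          exact (norm_inner_le_norm _ _).trans (by gcongr; exact (mem_ball_iff_norm.1 h).le)
  calc ‖(inner 𝕜 x u : 𝕜)‖ ^ 2 ≤ (r * ‖u‖ + ‖(inner 𝕜 y u : 𝕜)‖) ^ 2 := by gcongr
    _ ≤ _ := by nlinarith [sq_nonneg (r * ‖u‖ - ‖(inner 𝕜 y u : 𝕜)‖)]

theorem exists_finite_rank_norm_inner_sq_le {K : Set H} (hK : TotallyBounded K) {ε : ℝ}
    (hε : 0 < ε) :
    ∃ (k : ℕ) (T : H →L[𝕜] EuclideanSpace 𝕜 (Fin k)), ∀ x ∈ K, ∀ u,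
      ‖(inner 𝕜 x u : 𝕜)‖ ^ 2 ≤ ε * ‖u‖ ^ 2 + ‖T u‖ ^ 2 := by
  obtain ⟨t, ht, hcover⟩ := Metric.totallyBounded_iff.1 hK (Real.sqrt (ε / 2)) (by positivity)
  have := ht.to_subtype
  obtain ⟨k, ⟨e⟩⟩ := Finite.exists_equiv_fin t
  let T : H →L[𝕜] EuclideanSpace 𝕜 (Fin k) :=
    (EuclideanSpace.equiv (Fin k) 𝕜).symm.toContinuousLinearMap.comp
      (ContinuousLinearMap.pi fun i => innerSL 𝕜 (e.symm i : H))
  refine ⟨k, (Real.sqrt 2 : 𝕜) • T, fun x hx u => ?_⟩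
  obtain ⟨y, hy, hxy⟩ := mem_iUnion₂.1 (hcover hx)
  have hyT : ‖(inner 𝕜 y u : 𝕜)‖ ^ 2 ≤ ‖T u‖ ^ 2 := by
    have h := PiLp.norm_apply_le (T u) (e ⟨y, hy⟩)
    rw [show T u (e ⟨y, hy⟩) = inner 𝕜 y u by simp [T]] at h
    gcongr
  have hball := norm_inner_sq_le_of_mem_ball (𝕜 := 𝕜) hxy u
  rw [Real.sq_sqrt (by positivity)] at hball
  rw [norm_sq_sqrt_smul_apply T zero_le_two]
  linarith

end FiniteRank

section Compactness

variable {n : ℕ} {Ω : Opens (Space n)}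

open scoped FourierTransform SchwartzMap LineDeriv

/-- A test function, regarded as a Schwartz function. -/
def toSchwartz (φ : 𝓓(Ω, ℂ)) : 𝓢(Space n, ℂ) := φ.hasCompactSupport.toSchwartzMap φ.contDiff

/-- The Fourier transform `φ̂(ξ) = ∫ e^{-2πi⟨x, ξ⟩} φ(x) dx` of a test function; in this
normalization `P(D)` has the symbol `P(2πξ)`. -/
def hat (φ : 𝓓(Ω, ℂ)) : 𝓢(Space n, ℂ) := 𝓕 (toSchwartz φ)

theorem hat_add (φ ψ : 𝓓(Ω, ℂ)) : hat (φ + ψ) = hat φ + hat ψ := by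
  rw [hat, hat, hat, ← FourierTransform.fourier_add]
  rfl

theorem hat_smul (c : ℂ) (φ : 𝓓(Ω, ℂ)) : hat (c • φ) = c • hat φ := by
  rw [hat, hat, ← FourierTransform.fourier_smul]
  rfl

theorem hat_dOp (k : Fin n) (φ : 𝓓(Ω, ℂ)) (ξ : Space n) :
    hat (dOp Ω k φ) ξ = ((2 * Real.pi * ξ k : ℝ) : ℂ) * hat φ ξ := by
  have h : toSchwartz (dOp Ω k φ) =
      (-Complex.I) • ∂_{(EuclideanSpace.single k (1 : ℝ) : Space n)} (toSchwartz φ) := by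
    ext x
    exact dOp_apply k φ x
  have ht : (fun x : Space n =>
      (inner ℝ x (EuclideanSpace.single k (1 : ℝ) : Space n) : ℝ)).HasTemperateGrowth :=
    ((innerSL ℝ).flip (EuclideanSpace.single k (1 : ℝ) : Space n)).hasTemperateGrowth
  rw [hat, h, FourierTransform.fourier_smul, SchwartzMap.fourier_lineDerivOp_eq, smul_apply,
    smul_apply, SchwartzMap.smulLeftCLM_apply_apply ht]
  simp only [EuclideanSpace.inner_single_right, smul_eq_mul, Complex.real_smul, hat, conj_trivial]
  push_cast
  linear_combination (-(2 * Real.pi * ξ k * 𝓕 (toSchwartz φ) ξ)) * Complex.I_mul_I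

theorem hat_diffOp (Q : MvPolynomial (Fin n) ℂ) (φ : 𝓓(Ω, ℂ)) (ξ : Space n) :
    hat (diffOp Ω Q φ) ξ =
      MvPolynomial.eval (fun k => ((2 * Real.pi * ξ k : ℝ) : ℂ)) Q * hat φ ξ := by
  induction Q using MvPolynomial.induction_on generalizing φ with
  | C c => rw [diffOp_C, hat_smul, MvPolynomial.eval_C]; rfl
  | add Q R hQ hR =>
    rw [map_add, LinearMap.add_apply, hat_add, add_apply, hQ, hR, map_add, add_mul]
  | mul_X Q k hQ =>
    rw [diffOp_mul_apply, hQ, diffOp_X, hat_dOp, map_mul, MvPolynomial.eval_X, ← mul_assoc]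

theorem hat_polyOp (P : MvPolynomial (Fin n) ℝ) (φ : 𝓓(Ω, ℂ)) (ξ : Space n) :
    hat (polyOp P Ω φ) ξ = ((symbol P ((2 * Real.pi) • ξ) : ℝ) : ℂ) * hat φ ξ := by
  rw [polyOp_eq_diffOp, hat_diffOp, MvPolynomial.eval_map]
  congr 1
  exact (MvPolynomial.eval₂_comp_left Complex.ofRealHom (RingHom.id ℝ)
    (fun k => 2 * Real.pi * ξ k) P).symm

theorem inner_testToL2_eq_integral_hat (φ ψ : 𝓓(Ω, ℂ)) :
    inner ℂ (testToL2 Ω φ) (testToL2 Ω ψ) = ∫ ξ, starRingEnd ℂ (hat φ ξ) * hat ψ ξ := by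
  have h := SchwartzMap.integral_inner_fourier_fourier (toSchwartz φ) (toSchwartz ψ)
  simp only [RCLike.inner_apply'] at h
  rw [inner_testToL2_testToL2]
  exact h.symm

theorem norm_sq_testToL2 (φ : 𝓓(Ω, ℂ)) :
    ‖testToL2 Ω φ‖ ^ 2 = ∫ ξ, ‖hat φ ξ‖ ^ 2 := by
  have h := inner_testToL2_eq_integral_hat φ φ
  rw [inner_self_eq_norm_sq_to_K] at h
  simp only [Complex.conj_mul'] at h
  norm_cast at h
  exact Complex.ofReal_injective h

theorem integrable_norm_sq_hat (φ : 𝓓(Ω, ℂ)) : Integrable fun ξ => ‖hat φ ξ‖ ^ 2 :=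
  ((hat φ).memLp 2).integrable_norm_pow (by norm_num)

theorem inner_polyOp_eq_integral (P : MvPolynomial (Fin n) ℝ) (φ : 𝓓(Ω, ℂ)) :
    inner ℂ (testToL2 Ω φ) (testToL2 Ω (polyOp P Ω φ)) =
      ((∫ ξ, symbol P ((2 * Real.pi) • ξ) * ‖hat φ ξ‖ ^ 2 : ℝ) : ℂ) := by
  rw [inner_testToL2_eq_integral_hat, ← integral_complex_ofReal]
  congr 1 with ξ
  rw [hat_polyOp, mul_left_comm, Complex.conj_mul']
  push_cast
  rfl

theorem re_inner_polyOp_ge {P : MvPolynomial (Fin n) ℝ} {c : ℝ} (hc : ∀ ξ, c ≤ symbol P ξ)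
    (φ : 𝓓(Ω, ℂ)) :
    c * ‖testToL2 Ω φ‖ ^ 2 ≤ (inner ℂ (testToL2 Ω φ) (testToL2 Ω (polyOp P Ω φ))).re := by
  have hnonneg : 0 ≤ (inner ℂ (testToL2 Ω φ)
      (testToL2 Ω (polyOp (P - MvPolynomial.C c) Ω φ))).re := by
    rw [inner_polyOp_eq_integral, Complex.ofReal_re]
    refine integral_nonneg fun ξ => mul_nonneg ?_ (sq_nonneg _)
    rw [symbol, map_sub, MvPolynomial.eval_C]
    exact sub_nonneg.2 (hc _)
  have hself : (inner ℂ (testToL2 Ω φ) (testToL2 Ω φ)).re = ‖testToL2 Ω φ‖ ^ 2 :=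
    inner_self_eq_norm_sq (𝕜 := ℂ) _
  rw [polyOp_sub_C, map_sub, map_smul, inner_sub_right, inner_smul_right, Complex.sub_re,
    Complex.re_ofReal_mul, hself] at hnonneg
  linarith

theorem dominates_polyDeriv (hΩ : Bornology.IsBounded (Ω : Set (Space n)))
    (P : MvPolynomial (Fin n) ℝ) (α : Fin n → ℕ) :
    Dominates Ω (toComplex P) (toComplex (polyDeriv α P)) := by
  let good : Submonoid (Module.End ℝ (MvPolynomial (Fin n) ℝ)) :=
    { carrier := {A | ∀ R, Dominates Ω (toComplex R) (toComplex (A R))}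
      one_mem' := fun R => Dominates.refl _
      mul_mem' := fun hA hB R => (hB R).trans (hA _) }
  have hgood : ∀ j, ((MvPolynomial.pderiv j).toLinearMap :
      Module.End ℝ (MvPolynomial (Fin n) ℝ)) ∈ good := fun j R => by
    have h := dominates_pderiv hΩ j (toComplex R)
    rwa [MvPolynomial.pderiv_map] at h
  refine Submonoid.list_prod_mem good (fun A hA => ?_) P
  obtain ⟨j, rfl⟩ := (List.mem_ofFn' _ _).1 hA
  exact pow_mem (hgood j) _

theorem symbolTilde_sq_mul_norm_sq_hat (P : MvPolynomial (Fin n) ℝ) (φ : 𝓓(Ω, ℂ)) (ξ : Space n) :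
    symbolTilde P ((2 * Real.pi) • ξ) ^ 2 * ‖hat φ ξ‖ ^ 2 =
      ∑ α : Fin n → Fin (P.totalDegree + 1),
        ‖hat (polyOp (polyDeriv (fun j => (α j : ℕ)) P) Ω φ) ξ‖ ^ 2 := by
  rw [symbolTilde, Real.sq_sqrt (by positivity), Finset.sum_mul]
  refine Finset.sum_congr rfl fun α _ => ?_
  rw [hat_polyOp, norm_mul, Complex.norm_real, Real.norm_eq_abs, mul_pow]

theorem integrable_symbolTilde_sq_mul (P : MvPolynomial (Fin n) ℝ) (φ : 𝓓(Ω, ℂ)) :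
    Integrable fun ξ => symbolTilde P ((2 * Real.pi) • ξ) ^ 2 * ‖hat φ ξ‖ ^ 2 := by
  simp only [symbolTilde_sq_mul_norm_sq_hat]
  exact integrable_finsetSum _ fun α _ => integrable_norm_sq_hat _

theorem exists_integral_symbolTilde_le (hΩ : Bornology.IsBounded (Ω : Set (Space n)))
    (P : MvPolynomial (Fin n) ℝ) :
    ∃ C : ℝ, 0 < C ∧ ∀ φ : 𝓓(Ω, ℂ),
      ∫ ξ, symbolTilde P ((2 * Real.pi) • ξ) ^ 2 * ‖hat φ ξ‖ ^ 2 ≤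
        C * ‖testToL2 Ω (polyOp P Ω φ)‖ ^ 2 := by
  choose C hCle using fun α : Fin n → Fin (P.totalDegree + 1) =>
    (dominates_polyDeriv hΩ P (fun j => (α j : ℕ))).exists_norm_le
  refine ⟨∑ α, C α ^ 2 + 1, by positivity, fun φ => ?_⟩
  simp only [symbolTilde_sq_mul_norm_sq_hat]
  rw [integral_finsetSum _ fun α _ => integrable_norm_sq_hat _, add_mul, Finset.sum_mul]
  refine le_add_of_le_of_nonneg (Finset.sum_le_sum fun α _ => ?_) (by positivity)
  rw [← norm_sq_testToL2, ← mul_pow, polyOp_eq_diffOp, polyOp_eq_diffOp]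
  exact pow_le_pow_left₀ (norm_nonneg _) (hCle α φ) 2

theorem exists_high_frequency_le (hΩ : Bornology.IsBounded (Ω : Set (Space n)))
    {P : MvPolynomial (Fin n) ℝ}
    (hP : Tendsto (symbolTilde P) (cocompact (Space n)) atTop) {ε : ℝ} (hε : 0 < ε) :
    ∃ R : ℝ, ∀ φ : 𝓓(Ω, ℂ), ∫ ξ in (Metric.closedBall 0 R)ᶜ, ‖hat φ ξ‖ ^ 2 ≤
      ε * ‖testToL2 Ω (polyOp P Ω φ)‖ ^ 2 := by
  obtain ⟨C, hC, hCle⟩ := exists_integral_symbolTilde_le hΩ P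
  have hlarge : ∀ᶠ ξ in cocompact (Space n),
      C / ε ≤ symbolTilde P ((2 * Real.pi) • ξ) ^ 2 := by
    have hdil : Tendsto (fun ξ : Space n => (2 * Real.pi) • ξ) (cocompact _) (cocompact _) :=
      (Homeomorph.smulOfNeZero (2 * Real.pi) (by positivity)).isClosedEmbedding.tendsto_cocompact
    exact ((tendsto_pow_atTop two_ne_zero).comp (hP.comp hdil)).eventually_ge_atTop _
  obtain ⟨R, hR⟩ : ∃ R, (Metric.closedBall (0 : Space n) R)ᶜ ⊆
      {ξ | C / ε ≤ symbolTilde P ((2 * Real.pi) • ξ) ^ 2} := by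
    rw [← Metric.cobounded_eq_cocompact] at hlarge
    obtain ⟨R, -, hR⟩ := (Metric.hasBasis_cobounded_compl_closedBall (0 : Space n)).mem_iff.1 hlarge
    exact ⟨R, hR⟩
  have hg : ∀ φ : 𝓓(Ω, ℂ), Integrable fun ξ =>
      ε / C * (symbolTilde P ((2 * Real.pi) • ξ) ^ 2 * ‖hat φ ξ‖ ^ 2) := fun φ =>
    (integrable_symbolTilde_sq_mul P φ).const_mul _
  refine ⟨R, fun φ => ?_⟩
  calc ∫ ξ in (Metric.closedBall 0 R)ᶜ, ‖hat φ ξ‖ ^ 2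
      ≤ ∫ ξ in (Metric.closedBall 0 R)ᶜ,
          ε / C * (symbolTilde P ((2 * Real.pi) • ξ) ^ 2 * ‖hat φ ξ‖ ^ 2) := by
        refine setIntegral_mono_on (integrable_norm_sq_hat φ).integrableOn (hg φ).integrableOn
          measurableSet_closedBall.compl fun ξ hξ => ?_
        rw [← mul_assoc]
        refine le_mul_of_one_le_left (sq_nonneg _) ?_
        have h : C / ε ≤ symbolTilde P ((2 * Real.pi) • ξ) ^ 2 := hR hξ
        rw [div_le_iff₀ hε] at h
        rw [div_mul_eq_mul_div, le_div_iff₀ hC]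
        linarith
    _ ≤ ∫ ξ, ε / C * (symbolTilde P ((2 * Real.pi) • ξ) ^ 2 * ‖hat φ ξ‖ ^ 2) :=
        setIntegral_le_integral (hg φ) (Eventually.of_forall fun ξ => by positivity)
    _ ≤ ε / C * (C * ‖testToL2 Ω (polyOp P Ω φ)‖ ^ 2) := by
        rw [integral_const_mul]
        gcongr
        exact hCle φ
    _ = ε * ‖testToL2 Ω (polyOp P Ω φ)‖ ^ 2 := by field_simp

/-- The exponential `x ↦ exp(2πi ⟨x, ξ⟩)`. -/
def expFun (ξ x : Space n) : ℂ := Complex.exp ((2 * Real.pi * inner ℝ x ξ : ℝ) * Complex.I)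

theorem norm_expFun (ξ x : Space n) : ‖expFun ξ x‖ = 1 := Complex.norm_exp_ofReal_mul_I _

theorem continuous_expFun (ξ : Space n) : Continuous (expFun ξ) := by
  unfold expFun
  fun_prop

theorem norm_expFun_sub_le {A : ℝ} {ξ η x : Space n} (hx : ‖x‖ ≤ A) :
    ‖expFun ξ x - expFun η x‖ ≤ 2 * Real.pi * A * ‖ξ - η‖ := by
  have hfactor : expFun ξ x - expFun η x = expFun η x *
      (Complex.exp (Complex.I * (2 * Real.pi * inner ℝ x (ξ - η) : ℝ)) - 1) := by
    dsimp only [expFun]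
    rw [mul_sub, ← Complex.exp_add, mul_one, inner_sub_right]
    congr 2
    push_cast
    ring
  rw [hfactor, norm_mul, norm_expFun, one_mul]
  refine Real.norm_exp_I_mul_ofReal_sub_one_le.trans ?_
  rw [norm_mul, Real.norm_of_nonneg (by positivity), mul_assoc (2 * Real.pi)]
  gcongr
  exact (norm_inner_le_norm _ _).trans (by gcongr)

theorem isFiniteMeasure_restrict_of_isBounded (hΩ : Bornology.IsBounded (Ω : Set (Space n))) :
    IsFiniteMeasure ((volume : Measure (Space n)).restrict (Ω : Set (Space n))) :=
  ⟨by simpa using hΩ.measure_lt_top⟩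

theorem memLp_expFun (hΩ : Bornology.IsBounded (Ω : Set (Space n))) (ξ : Space n) :
    MemLp (expFun ξ) 2 (volume.restrict (Ω : Set (Space n))) :=
  have := isFiniteMeasure_restrict_of_isBounded hΩ
  MemLp.of_bound (continuous_expFun ξ).aestronglyMeasurable 1
    (Eventually.of_forall fun x => (norm_expFun ξ x).le)

theorem hat_eq_inner (hΩ : Bornology.IsBounded (Ω : Set (Space n))) (φ : 𝓓(Ω, ℂ)) (ξ : Space n) :
    hat φ ξ = inner ℂ (memLp_expFun hΩ ξ).toLp (testToL2 Ω φ) := by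
  have hhat : hat φ ξ = ∫ x, starRingEnd ℂ (expFun ξ x) * φ x := by
    rw [hat, SchwartzMap.fourier_coe, Real.fourier_eq']
    congr 1 with x
    change Complex.exp _ * φ x = _
    dsimp only [expFun]
    rw [← Complex.exp_conj, map_mul, Complex.conj_ofReal, Complex.conj_I]
    congr 2
    push_cast
    ring
  rw [MeasureTheory.L2.inner_def, hhat,
    ← setIntegral_eq_integral_of_forall_compl_eq_zero (s := (Ω : Set (Space n)))]
  · refine integral_congr_ae ?_
    filter_upwards [(memLp_expFun hΩ ξ).coeFn_toLp, coeFn_testToL2 φ] with x h1 h2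
    rw [h1, h2, RCLike.inner_apply']
  · intro x hx
    rw [image_eq_zero_of_notMem_tsupport fun h => hx (φ.tsupport_subset h), mul_zero]

theorem continuous_toLp_expFun (hΩ : Bornology.IsBounded (Ω : Set (Space n))) :
    Continuous fun ξ => ((memLp_expFun hΩ ξ).toLp : L2 Ω) := by
  obtain ⟨A, hA0, hA⟩ := hΩ.exists_pos_norm_le
  have := isFiniteMeasure_restrict_of_isBounded hΩ
  set μ := (volume : Measure (Space n)).restrict (Ω : Set (Space n))
  refine (LipschitzWith.of_dist_le' (K := measureUnivNNReal μ ^ (ENNReal.toReal 2)⁻¹ *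
    (2 * Real.pi * A)) fun ξ η => ?_).continuous
  rw [dist_eq_norm, dist_eq_norm, ← MemLp.toLp_sub, mul_assoc]
  refine Lp.norm_le_of_ae_bound (by positivity) ?_
  filter_upwards [MemLp.coeFn_toLp ((memLp_expFun hΩ ξ).sub (memLp_expFun hΩ η)),
    ae_restrict_mem Ω.isOpen.measurableSet] with x hsub hx
  rw [hsub]
  exact norm_expFun_sub_le (hA x hx)

theorem exists_low_frequency_le (hΩ : Bornology.IsBounded (Ω : Set (Space n))) (R : ℝ) {ε : ℝ}
    (hε : 0 < ε) :
    ∃ (k : ℕ) (T : L2 Ω →L[ℂ] EuclideanSpace ℂ (Fin k)), ∀ φ : 𝓓(Ω, ℂ),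
      ∫ ξ in Metric.closedBall 0 R, ‖hat φ ξ‖ ^ 2 ≤
        ε * ‖testToL2 Ω φ‖ ^ 2 + ‖T (testToL2 Ω φ)‖ ^ 2 := by
  set v : ℝ := (volume : Measure (Space n)).real (Metric.closedBall 0 R)
  have hv : 0 ≤ v := measureReal_nonneg
  have hK : TotallyBounded ((fun ξ => ((memLp_expFun hΩ ξ).toLp : L2 Ω)) ''
      Metric.closedBall 0 R) :=
    ((isCompact_closedBall 0 R).image (continuous_toLp_expFun hΩ)).totallyBounded
  obtain ⟨k, T, hT⟩ := exists_finite_rank_norm_inner_sq_le (𝕜 := ℂ) hK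
    (show 0 < ε / (v + 1) by positivity)
  refine ⟨k, (Real.sqrt v : ℂ) • T, fun φ => ?_⟩
  calc ∫ ξ in Metric.closedBall 0 R, ‖hat φ ξ‖ ^ 2
      ≤ ∫ _ in Metric.closedBall (0 : Space n) R,
          (ε / (v + 1) * ‖testToL2 Ω φ‖ ^ 2 + ‖T (testToL2 Ω φ)‖ ^ 2) := by
        refine setIntegral_mono_on (integrable_norm_sq_hat φ).integrableOn
          (integrableOn_const measure_closedBall_lt_top.ne) measurableSet_closedBall fun ξ hξ => ?_
        rw [hat_eq_inner hΩ]
        exact hT _ (mem_image_of_mem _ hξ) _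
    _ = ε * (v / (v + 1)) * ‖testToL2 Ω φ‖ ^ 2 + v * ‖T (testToL2 Ω φ)‖ ^ 2 := by
        rw [setIntegral_const, smul_eq_mul]
        ring
    _ ≤ ε * ‖testToL2 Ω φ‖ ^ 2 + v * ‖T (testToL2 Ω φ)‖ ^ 2 := by
        gcongr
        exact mul_le_of_le_one_right hε.le ((div_le_one (by positivity)).2 (by linarith))
    _ = _ := congrArg _ (norm_sq_sqrt_smul_apply T hv _).symm

/-- A quantitative form of the compactness of the embedding `H₀^P(Ω) → L²(Ω)`. -/
theorem exists_finite_rank_estimate (hΩ : Bornology.IsBounded (Ω : Set (Space n)))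
    {P : MvPolynomial (Fin n) ℝ}
    (hP : Tendsto (symbolTilde P) (cocompact (Space n)) atTop) {ε : ℝ} (hε : 0 < ε) :
    ∃ (k : ℕ) (T : L2 Ω →L[ℂ] EuclideanSpace ℂ (Fin k)), ∀ φ : 𝓓(Ω, ℂ),
      ‖testToL2 Ω φ‖ ^ 2 ≤ ε * ‖testToL2 Ω (polyOp P Ω φ)‖ ^ 2 + ‖T (testToL2 Ω φ)‖ ^ 2 := by
  obtain ⟨R, hhigh⟩ := exists_high_frequency_le hΩ hP (half_pos hε)
  obtain ⟨k, T, hlow⟩ := exists_low_frequency_le hΩ R (one_half_pos (α := ℝ))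
  refine ⟨k, (Real.sqrt 2 : ℂ) • T, fun φ => ?_⟩
  have hsplit := integral_add_compl (measurableSet_closedBall (x := (0 : Space n)) (ε := R))
    (integrable_norm_sq_hat φ)
  rw [← norm_sq_testToL2] at hsplit
  have hT : ‖((Real.sqrt 2 : ℂ) • T) (testToL2 Ω φ)‖ ^ 2 = 2 * ‖T (testToL2 Ω φ)‖ ^ 2 :=
    norm_sq_sqrt_smul_apply T zero_le_two _
  linarith [hhigh φ, hlow φ]

end Compactness

/-! ### The form of the transmission problem -/

section FormOperator

variable {𝕜 X H : Type*} [RCLike 𝕜] [NormedAddCommGroup X] [InnerProductSpace 𝕜 X]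
  [NormedAddCommGroup H] [InnerProductSpace 𝕜 H]
  {J D : X →L[𝕜] H} {S : H →L[𝕜] H} {m δ c l : ℝ}

/-- The operator `D - l` for an unbounded operator on `H`, encoded by its domain `X` (with the graph
norm), the inclusion `J : X → H` and the operator itself `D : X → H`. -/
def pencil (J D : X →L[𝕜] H) (l : ℝ) : X →L[𝕜] H :=
  D - (l : 𝕜) • J

theorem pencil_apply (u : X) : pencil J D l u = D u - (l : 𝕜) • J u := rfl

theorem continuous_pencil (J D : X →L[𝕜] H) : Continuous (pencil J D) := by
  unfold pencil
  fun_prop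

theorem inner_pencil_symm (hsymm : ∀ u v, inner 𝕜 (D u) (J v) = inner 𝕜 (J u) (D v)) (u v : X) :
    inner 𝕜 (pencil J D l u) (J v) = inner 𝕜 (J u) (pencil J D l v) := by
  rw [pencil_apply, pencil_apply, inner_sub_left, inner_sub_right, hsymm, inner_smul_left,
    inner_smul_right, RCLike.conj_ofReal]

theorem re_inner_pencil (u : X) : RCLike.re (inner 𝕜 (pencil J D l u) (J u)) =
    RCLike.re (inner 𝕜 (D u) (J u)) - l * ‖J u‖ ^ 2 := by
  rw [pencil_apply, inner_sub_left, inner_smul_left, RCLike.conj_ofReal, map_sub,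
    RCLike.re_ofReal_mul, inner_self_eq_norm_sq]

theorem norm_sq_pencil (u : X) : ‖pencil J D l u‖ ^ 2 =
    ‖D u‖ ^ 2 - 2 * l * RCLike.re (inner 𝕜 (D u) (J u)) + l ^ 2 * ‖J u‖ ^ 2 := by
  rw [pencil_apply, norm_sub_sq (𝕜 := 𝕜), inner_smul_right, RCLike.re_ofReal_mul, norm_smul,
    RCLike.norm_ofReal, mul_pow, sq_abs]
  ring

theorem norm_sq_le_pencil (J D : X →L[𝕜] H) (l : ℝ) (u : X) :
    ‖D u‖ ^ 2 ≤ 2 * ‖pencil J D l u‖ ^ 2 + 2 * l ^ 2 * ‖J u‖ ^ 2 := by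
  have h : ‖D u‖ ≤ ‖pencil J D l u‖ + |l| * ‖J u‖ := by
    calc ‖D u‖ = ‖pencil J D l u + (l : 𝕜) • J u‖ := by rw [pencil_apply, sub_add_cancel]
      _ ≤ _ := (norm_add_le _ _).trans_eq (by rw [norm_smul, RCLike.norm_ofReal])
  calc ‖D u‖ ^ 2 ≤ (‖pencil J D l u‖ + |l| * ‖J u‖) ^ 2 := by gcongr
    _ ≤ 2 * (‖pencil J D l u‖ ^ 2 + (|l| * ‖J u‖) ^ 2) := add_sq_le
    _ = _ := by rw [mul_pow, sq_abs]; ring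

variable [CompleteSpace X] [CompleteSpace H]

/-- The operator on `X` representing the form `⟪S (D - l) u, (D - l) v⟫ + ⟪(D - l) u, v⟫`.
For `S` the multiplication by `1 / V` its kernel is that of `T_l = (D + V - l) V⁻¹ (D - l)`. -/
def formOp (J D : X →L[𝕜] H) (S : H →L[𝕜] H) (l : ℝ) : X →L[𝕜] X :=
  (pencil J D l).adjoint ∘L S ∘L pencil J D l + J.adjoint ∘L pencil J D l

theorem inner_formOp (u v : X) : inner 𝕜 (formOp J D S l u) v =
    inner 𝕜 (S (pencil J D l u)) (pencil J D l v) + inner 𝕜 (pencil J D l u) (J v) := by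
  simp only [formOp, add_apply, ContinuousLinearMap.comp_apply, inner_add_left,
    ContinuousLinearMap.adjoint_inner_left]

theorem reApplyInnerSelf_formOp (u : X) : (formOp J D S l).reApplyInnerSelf u =
    S.reApplyInnerSelf (pencil J D l u) + RCLike.re (inner 𝕜 (pencil J D l u) (J u)) := by
  simp only [ContinuousLinearMap.reApplyInnerSelf_apply, inner_formOp, map_add]

theorem continuous_formOp (J D : X →L[𝕜] H) (S : H →L[𝕜] H) : Continuous (formOp J D S) := by
  have hp := continuous_pencil J D
  have hadj : Continuous fun l => (pencil J D l).adjoint :=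
    (ContinuousLinearMap.adjoint (𝕜 := 𝕜) (E := X) (F := H)).continuous.comp hp
  exact (hadj.clm_comp (continuous_const.clm_comp hp)).add (continuous_const.clm_comp hp)

theorem isSymmetric_formOp (hsymm : ∀ u v, inner 𝕜 (D u) (J v) = inner 𝕜 (J u) (D v))
    (hS : (S : H →ₗ[𝕜] H).IsSymmetric) (l : ℝ) : (formOp J D S l : X →ₗ[𝕜] X).IsSymmetric := by
  intro u v
  change inner 𝕜 (formOp J D S l u) v = inner 𝕜 u (formOp J D S l v)
  rw [← inner_conj_symm u, inner_formOp, inner_formOp, map_add, inner_conj_symm, inner_conj_symm,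
    inner_pencil_symm hsymm]
  exact congrArg (· + _) (hS _ _)

theorem norm_sq_le_reApplyInnerSelf_formOp (hm : 0 < m)
    (hS : ∀ f, m * ‖f‖ ^ 2 ≤ S.reApplyInnerSelf f) (u : X) :
    m / 4 * ‖D u‖ ^ 2 ≤
      (formOp J D S l).reApplyInnerSelf u + (m * l ^ 2 / 2 + m⁻¹ / 2) * ‖J u‖ ^ 2 := by
  have hD := norm_sq_le_pencil J D l u
  set f := pencil J D l u with hf
  have hinner : -(‖f‖ * ‖J u‖) ≤ RCLike.re (inner 𝕜 f (J u)) :=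
    (abs_le.1 ((RCLike.abs_re_le_norm _).trans (norm_inner_le_norm f (J u)))).1
  have hyoung : ‖f‖ * ‖J u‖ ≤ m / 2 * ‖f‖ ^ 2 + m⁻¹ / 2 * ‖J u‖ ^ 2 := by
    have hsq : 0 ≤ m / 2 * (‖f‖ - m⁻¹ * ‖J u‖) ^ 2 := by positivity
    have hexp : m / 2 * (‖f‖ - m⁻¹ * ‖J u‖) ^ 2 =
        m / 2 * ‖f‖ ^ 2 - ‖f‖ * ‖J u‖ + m⁻¹ / 2 * ‖J u‖ ^ 2 := by
      field_simp
      ring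
    linarith
  rw [reApplyInnerSelf_formOp, ← hf]
  linarith [hS f, mul_le_mul_of_nonneg_left hD (show 0 ≤ m / 4 by positivity)]

theorem coerciveModFiniteRank_formOp (hnorm : ∀ u, ‖u‖ ^ 2 ≤ ‖J u‖ ^ 2 + ‖D u‖ ^ 2)
    (hcomp : ∀ ε > 0, ∃ (k : ℕ) (T : X →L[𝕜] EuclideanSpace 𝕜 (Fin k)),
      ∀ u, ‖J u‖ ^ 2 ≤ ε * ‖D u‖ ^ 2 + ‖T u‖ ^ 2)
    (hm : 0 < m) (hS : ∀ f, m * ‖f‖ ^ 2 ≤ S.reApplyInnerSelf f) (l : ℝ) :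
    CoerciveModFiniteRank (formOp J D S l) := by
  set K := m / 8 + (m * l ^ 2 / 2 + m⁻¹ / 2) with hK
  have hK0 : 0 < K := by positivity
  obtain ⟨k, T, hT⟩ := hcomp (m / (8 * K)) (by positivity)
  refine ⟨k, ((√K : ℝ) : 𝕜) • T, m / 8, by positivity, fun u => ?_⟩
  have hJ : K * ‖J u‖ ^ 2 ≤ m / 8 * ‖D u‖ ^ 2 + K * ‖T u‖ ^ 2 := by
    calc _ ≤ K * (m / (8 * K) * ‖D u‖ ^ 2 + ‖T u‖ ^ 2) := by gcongr; exact hT u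
      _ = _ := by field_simp
  have hD := norm_sq_le_reApplyInnerSelf_formOp (J := J) (D := D) (l := l) hm hS u
  rw [norm_sq_sqrt_smul_apply T hK0.le u]
  have hu := mul_le_mul_of_nonneg_left (hnorm u) (show 0 ≤ m / 8 by positivity)
  rw [hK, add_mul] at hJ
  rw [hK]
  linarith

theorem formOp_pos_of_lt (hJ : Function.Injective J) (hS : ∀ f, 0 ≤ S.reApplyInnerSelf f)
    (hc : ∀ u, c * ‖J u‖ ^ 2 ≤ RCLike.re (inner 𝕜 (D u) (J u))) (hl : l < c) {u : X}
    (hu : u ≠ 0) : 0 < (formOp J D S l).reApplyInnerSelf u := by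
  have hJu : 0 < ‖J u‖ ^ 2 := by
    have := (map_ne_zero_iff J hJ).2 hu
    positivity
  rw [reApplyInnerSelf_formOp, re_inner_pencil]
  linarith [hS (pencil J D l u), hc u, mul_lt_mul_of_pos_right hl hJu]

theorem formOp_pos_of_inv_lt (hJ : Function.Injective J) (hm : 0 < m)
    (hS : ∀ f, m * ‖f‖ ^ 2 ≤ S.reApplyInnerSelf f)
    (hc : ∀ u, c * ‖J u‖ ^ 2 ≤ -RCLike.re (inner 𝕜 (D u) (J u))) (hl : m⁻¹ < c + l) {u : X}
    (hu : u ≠ 0) : 0 < (formOp J D S l).reApplyInnerSelf u := by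
  have hJu : 0 < ‖J u‖ := norm_pos_iff.2 ((map_ne_zero_iff J hJ).2 hu)
  have hre := re_inner_pencil (J := J) (D := D) (l := l) u
  set f := pencil J D l u with hf
  have hinner : -(‖f‖ * ‖J u‖) ≤ RCLike.re (inner 𝕜 f (J u)) :=
    (abs_le.1 ((RCLike.abs_re_le_norm _).trans (norm_inner_le_norm f (J u)))).1
  have hfJ : (c + l) * ‖J u‖ ≤ ‖f‖ := by
    refine le_of_mul_le_mul_right ?_ hJu
    linarith [hc u]
  have hlt : ‖J u‖ < m * ‖f‖ := by
    rw [← inv_mul_lt_iff₀ hm]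
    exact (mul_lt_mul_of_pos_right hl hJu).trans_le hfJ
  have hf0 : 0 < ‖f‖ := pos_of_mul_pos_right (hJu.trans hlt) hm.le
  rw [reApplyInnerSelf_formOp, ← hf]
  linarith [hS f, mul_lt_mul_of_pos_left hlt hf0]

theorem formOp_half_nonpos (hδ : 0 < δ) (hS : ∀ f, S.reApplyInnerSelf f ≤ δ⁻¹ * ‖f‖ ^ 2) {u : X}
    (hu : 2 * ‖D u‖ ≤ δ * ‖J u‖) : (formOp J D S (δ / 2)).reApplyInnerSelf u ≤ 0 := by
  have hSu := hS (pencil J D (δ / 2) u)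
  rw [norm_sq_pencil] at hSu
  rw [reApplyInnerSelf_formOp, re_inner_pencil]
  set r := RCLike.re (inner 𝕜 (D u) (J u))
  have hexp : δ⁻¹ * (‖D u‖ ^ 2 - 2 * (δ / 2) * r + (δ / 2) ^ 2 * ‖J u‖ ^ 2) =
      δ⁻¹ * ‖D u‖ ^ 2 - r + δ / 4 * ‖J u‖ ^ 2 := by
    field_simp
    ring
  have hDu : δ⁻¹ * ‖D u‖ ^ 2 ≤ δ / 4 * ‖J u‖ ^ 2 := by
    rw [inv_mul_le_iff₀ hδ]
    have : (2 * ‖D u‖) ^ 2 ≤ (δ * ‖J u‖) ^ 2 := by gcongr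
    linarith
  linarith

theorem exists_kernels_formOp (hsymm : ∀ u v, inner 𝕜 (D u) (J v) = inner 𝕜 (J u) (D v))
    (hJ : Function.Injective J) (hnorm : ∀ u, ‖u‖ ^ 2 ≤ ‖J u‖ ^ 2 + ‖D u‖ ^ 2)
    (hcomp : ∀ ε > 0, ∃ (k : ℕ) (T : X →L[𝕜] EuclideanSpace 𝕜 (Fin k)),
      ∀ u, ‖J u‖ ^ 2 ≤ ε * ‖D u‖ ^ 2 + ‖T u‖ ^ 2)
    (hsemi : (∃ c : ℝ, ∀ u, c * ‖J u‖ ^ 2 ≤ RCLike.re (inner 𝕜 (D u) (J u))) ∨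
      ∃ c : ℝ, ∀ u, c * ‖J u‖ ^ 2 ≤ -RCLike.re (inner 𝕜 (D u) (J u)))
    (hS : (S : H →ₗ[𝕜] H).IsSymmetric) (hm : 0 < m)
    (hSm : ∀ f, m * ‖f‖ ^ 2 ≤ S.reApplyInnerSelf f) (hδ : 0 < δ)
    (hSδ : ∀ f, S.reApplyInnerSelf f ≤ δ⁻¹ * ‖f‖ ^ 2) {W : Submodule 𝕜 X}
    (hW : ∀ u ∈ W, 2 * ‖D u‖ ≤ δ * ‖J u‖) :
    ∃ ev : Fin (Module.finrank 𝕜 W) → ℝ, ∀ i,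
      (Finset.univ.filter fun j => ev j = ev i).card ≤
        Module.finrank 𝕜 (formOp J D S (ev i)).ker := by
  have hcont := continuous_formOp J D S
  have hself := isSymmetric_formOp hsymm hS
  have hcoer := coerciveModFiniteRank_formOp hnorm hcomp hm hSm
  have hneg : NonposOn (formOp J D S (δ / 2)) W := fun u hu => formOp_half_nonpos hδ hSδ (hW u hu)
  rcases hsemi with ⟨c, hc⟩ | ⟨c, hc⟩
  · have hS0 : ∀ f, 0 ≤ S.reApplyInnerSelf f := fun f => le_trans (by positivity) (hSm f)
    have hlt : min (c - 1) (δ / 2) < c := (min_le_left _ _).trans_lt (sub_one_lt c)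
    exact exists_kernels_of_path hcont hself hcoer (min_le_right _ _)
      (fun u hu => formOp_pos_of_lt hJ hS0 hc hlt hu) hneg
  · set L := max (m⁻¹ - c + 1) (δ / 2)
    have hlt : m⁻¹ < c + L := by linarith [le_max_left (m⁻¹ - c + 1) (δ / 2)]
    obtain ⟨ev, hev⟩ := exists_kernels_of_path (A := fun l => formOp J D S (-l)) (a := -L)
      (b := -(δ / 2)) (hcont.comp continuous_neg) (fun l => hself (-l)) (fun l => hcoer (-l))
      (neg_le_neg (le_max_right _ _))
      (fun u hu => by rw [neg_neg]; exact formOp_pos_of_inv_lt hJ hm hSm hc hlt hu)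
      (by rwa [neg_neg])
    exact ⟨fun i => -ev i, fun i => by simpa only [neg_inj] using hev i⟩

end FormOperator

/-! ### The graph space -/

section GraphSpace

variable {n : ℕ} {P : MvPolynomial (Fin n) ℝ} {Ω : Opens (Space n)}

theorem inner_symm_of_mem_minGraph {z w : L2 Ω × L2 Ω} (hz : z ∈ minGraph P Ω)
    (hw : w ∈ minGraph P Ω) : inner ℂ z.2 w.1 = inner ℂ z.1 w.2 := by
  refine minGraph_subset_of_isClosed (S := {z | inner ℂ z.2 w.1 = inner ℂ z.1 w.2})
    (isClosed_eq (by fun_prop) (by fun_prop)) (fun φ => ?_) hz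
  refine minGraph_subset_of_isClosed (S := {w | inner ℂ (testToL2 Ω (polyOp P Ω φ)) w.1 =
    inner ℂ (testToL2 Ω φ) w.2}) (isClosed_eq (by fun_prop) (by fun_prop)) (fun ψ => ?_) hw
  change inner ℂ (testToL2 Ω (polyOp P Ω φ)) (testToL2 Ω ψ) =
    inner ℂ (testToL2 Ω φ) (testToL2 Ω (polyOp P Ω ψ))
  rw [polyOp_eq_diffOp, inner_diffOp, conjPoly_toComplex]

theorem le_re_inner_of_mem_minGraph {c : ℝ} (hc : ∀ ξ, c ≤ symbol P ξ) {z : L2 Ω × L2 Ω}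
    (hz : z ∈ minGraph P Ω) : c * ‖z.1‖ ^ 2 ≤ (inner ℂ z.2 z.1).re := by
  refine minGraph_subset_of_isClosed
    (S := {z | c * ‖z.1‖ ^ 2 ≤ (inner ℂ z.2 z.1 : ℂ).re})
    (isClosed_le (by fun_prop) (Complex.continuous_re.comp (by fun_prop))) (fun φ => ?_) hz
  exact (re_inner_polyOp_ge hc φ).trans_eq (inner_re_symm (𝕜 := ℂ) _ _)

theorem neg_snd_mem_minGraph_neg {z : L2 Ω × L2 Ω} (hz : z ∈ minGraph P Ω) :
    (z.1, -z.2) ∈ minGraph (-P) Ω := by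
  refine minGraph_subset_of_isClosed (S := {z | (z.1, -z.2) ∈ minGraph (-P) Ω})
    ((Submodule.isClosed_topologicalClosure _).preimage (by fun_prop)) (fun φ => ?_) hz
  refine Submodule.le_topologicalClosure _ ⟨φ, Prod.ext rfl ?_⟩
  change testToL2 Ω (polyOp (-P) Ω φ) = -testToL2 Ω (polyOp P Ω φ)
  rw [polyOp_eq_diffOp, polyOp_eq_diffOp, map_neg, map_neg, LinearMap.neg_apply, map_neg]

theorem le_neg_re_inner_of_mem_minGraph {c : ℝ} (hc : ∀ ξ, c ≤ -symbol P ξ) {z : L2 Ω × L2 Ω}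
    (hz : z ∈ minGraph P Ω) : c * ‖z.1‖ ^ 2 ≤ -(inner ℂ z.2 z.1).re := by
  have hsymbol : ∀ ξ, c ≤ symbol (-P) ξ := fun ξ => by simpa [symbol] using hc ξ
  have h := le_re_inner_of_mem_minGraph hsymbol (neg_snd_mem_minGraph_neg hz)
  rwa [inner_neg_left, Complex.neg_re] at h

/-- The graph of `minOp P Ω` as a subspace of the Hilbert sum `L² ⊕ L²`: the space `H₀^P(Ω)` with
the graph norm. -/
def graphSpace (P : MvPolynomial (Fin n) ℝ) (Ω : Opens (Space n)) :
    Submodule ℂ (WithLp 2 (L2 Ω × L2 Ω)) :=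
  (minGraph P Ω).comap (WithLp.linearEquiv 2 ℂ (L2 Ω × L2 Ω)).toLinearMap

instance : CompleteSpace (graphSpace P Ω) := by
  have hc : IsClosed (minGraph P Ω : Set (L2 Ω × L2 Ω)) := Submodule.isClosed_topologicalClosure _
  have h : IsClosed (graphSpace P Ω : Set (WithLp 2 (L2 Ω × L2 Ω))) :=
    hc.preimage (WithLp.prodContinuousLinearEquiv 2 ℂ (L2 Ω) (L2 Ω)).continuous
  exact h.completeSpace_coe

/-- The inclusion `(u, P u) ↦ u` of the graph space into `L²(Ω)`. -/
def graphFst (P : MvPolynomial (Fin n) ℝ) (Ω : Opens (Space n)) : graphSpace P Ω →L[ℂ] L2 Ω :=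
  WithLp.fstL 2 ℂ (L2 Ω) (L2 Ω) ∘L (graphSpace P Ω).subtypeL

/-- The operator `(u, P u) ↦ P u` on the graph space. -/
def graphSnd (P : MvPolynomial (Fin n) ℝ) (Ω : Opens (Space n)) : graphSpace P Ω →L[ℂ] L2 Ω :=
  WithLp.sndL 2 ℂ (L2 Ω) (L2 Ω) ∘L (graphSpace P Ω).subtypeL

theorem graphFst_graphSnd_mem (u : graphSpace P Ω) :
    (graphFst P Ω u, graphSnd P Ω u) ∈ minGraph P Ω := u.2

theorem norm_sq_graphSpace (u : graphSpace P Ω) :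
    ‖u‖ ^ 2 = ‖graphFst P Ω u‖ ^ 2 + ‖graphSnd P Ω u‖ ^ 2 :=
  WithLp.prod_norm_sq_eq_of_L2 (u : WithLp 2 (L2 Ω × L2 Ω))

theorem graphFst_injective : Function.Injective (graphFst P Ω) := by
  refine (injective_iff_map_eq_zero _).2 fun u h => ?_
  have hsnd : graphSnd P Ω u = 0 := minGraph_single_valued P Ω _ (graphFst_graphSnd_mem u) h
  have hnorm := norm_sq_graphSpace u
  rw [h, hsnd] at hnorm
  simpa using hnorm

theorem inner_graphSnd_symm (u v : graphSpace P Ω) :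
    inner ℂ (graphSnd P Ω u) (graphFst P Ω v) = inner ℂ (graphFst P Ω u) (graphSnd P Ω v) :=
  inner_symm_of_mem_minGraph (graphFst_graphSnd_mem u) (graphFst_graphSnd_mem v)

theorem semibounded_graphSnd
    (hP : (∃ c : ℝ, ∀ ξ, c ≤ symbol P ξ) ∨ ∃ c : ℝ, ∀ ξ, c ≤ -symbol P ξ) :
    (∃ c : ℝ, ∀ u, c * ‖graphFst P Ω u‖ ^ 2 ≤
        RCLike.re (inner ℂ (graphSnd P Ω u) (graphFst P Ω u))) ∨
      ∃ c : ℝ, ∀ u, c * ‖graphFst P Ω u‖ ^ 2 ≤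
        -RCLike.re (inner ℂ (graphSnd P Ω u) (graphFst P Ω u)) :=
  hP.imp
    (fun ⟨c, hc⟩ => ⟨c, fun u => le_re_inner_of_mem_minGraph hc (graphFst_graphSnd_mem u)⟩)
    (fun ⟨c, hc⟩ => ⟨c, fun u => le_neg_re_inner_of_mem_minGraph hc (graphFst_graphSnd_mem u)⟩)

theorem exists_finite_rank_estimate_graphSpace
    (hΩ : Bornology.IsBounded (Ω : Set (Space n)))
    (hP : Tendsto (symbolTilde P) (cocompact (Space n)) atTop) {ε : ℝ} (hε : 0 < ε) :
    ∃ (k : ℕ) (T : graphSpace P Ω →L[ℂ] EuclideanSpace ℂ (Fin k)), ∀ u,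
      ‖graphFst P Ω u‖ ^ 2 ≤ ε * ‖graphSnd P Ω u‖ ^ 2 + ‖T u‖ ^ 2 := by
  obtain ⟨k, T, hT⟩ := exists_finite_rank_estimate hΩ hP hε
  refine ⟨k, T ∘L graphFst P Ω, fun u => ?_⟩
  exact minGraph_subset_of_isClosed (P := P)
    (S := {z | ‖z.1‖ ^ 2 ≤ ε * ‖z.2‖ ^ 2 + ‖T z.1‖ ^ 2})
    (isClosed_le (by fun_prop) (by fun_prop)) (fun φ => mem_ofPred.2 (hT φ))
    (graphFst_graphSnd_mem u)

theorem coe_minOp_mem_minGraph (u : H0 P Ω) : ((u : L2 Ω), minOp P Ω u) ∈ minGraph P Ω :=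
  Submodule.mem_graph_toLinearPMap (minGraph_single_valued P Ω) u

/-- The identification `u ↦ (u, P u)` of `H₀^P(Ω)` with the graph space. -/
def graphEquiv (P : MvPolynomial (Fin n) ℝ) (Ω : Opens (Space n)) :
    H0 P Ω ≃ₗ[ℂ] graphSpace P Ω where
  toFun u := ⟨WithLp.toLp 2 ((u : L2 Ω), minOp P Ω u), coe_minOp_mem_minGraph u⟩
  invFun z := ⟨graphFst P Ω z, _, graphFst_graphSnd_mem z, rfl⟩
  map_add' _ _ := graphFst_injective rfl
  map_smul' _ _ := graphFst_injective rfl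
  left_inv _ := rfl
  right_inv _ := graphFst_injective rfl

theorem graphFst_graphEquiv (u : H0 P Ω) : graphFst P Ω (graphEquiv P Ω u) = u := rfl

theorem graphSnd_graphEquiv (u : H0 P Ω) : graphSnd P Ω (graphEquiv P Ω u) = minOp P Ω u := rfl

/-- A test function `φ` as the element `(φ, P φ)` of the graph space. -/
def testGraph (P : MvPolynomial (Fin n) ℝ) (φ : 𝓓(Ω, ℂ)) : graphSpace P Ω :=
  ⟨WithLp.toLp 2 (testToL2 Ω φ, testToL2 Ω (polyOp P Ω φ)),
    Submodule.le_topologicalClosure _ ⟨φ, rfl⟩⟩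

theorem eq_zero_of_inner_testGraph {w : graphSpace P Ω}
    (h : ∀ φ : 𝓓(Ω, ℂ), inner ℂ w (testGraph P φ) = 0) : w = 0 := by
  have hw : inner ℂ (graphFst P Ω w) (graphFst P Ω w) +
      inner ℂ (graphSnd P Ω w) (graphSnd P Ω w) = (0 : ℂ) :=
    minGraph_subset_of_isClosed (S := {z | inner ℂ (graphFst P Ω w) z.1 +
      inner ℂ (graphSnd P Ω w) z.2 = (0 : ℂ)})
      (isClosed_eq (by fun_prop) (by fun_prop)) h (graphFst_graphSnd_mem w)
  exact inner_self_eq_zero.1 (show inner ℂ w w = (0 : ℂ) from hw)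

end GraphSpace

/-! ### Transmission eigenvalues -/

theorem exists_pos_ae_norm_le_of_memLp_top {α E : Type*} {mα : MeasurableSpace α} {μ : Measure α}
    [NormedAddCommGroup E] {f : α → E} (hf : MemLp f ⊤ μ) :
    ∃ M : ℝ, 0 < M ∧ ∀ᵐ x ∂μ, ‖f x‖ ≤ M := by
  have hfin : eLpNormEssSup f μ ≠ ⊤ := eLpNorm_exponent_top (f := f) ▸ hf.2.ne
  refine ⟨(eLpNormEssSup f μ).toReal + 1, by positivity, ?_⟩
  filter_upwards [enorm_ae_le_eLpNormEssSup f μ] with x hx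
  rw [← toReal_enorm]
  linarith [ENNReal.toReal_mono hfin hx]

theorem memLp_top_inv {α : Type*} {mα : MeasurableSpace α} {μ : Measure α} {f : α → ℝ} {δ : ℝ}
    (hf : AEStronglyMeasurable f μ) (hδ : 0 < δ) (hfδ : ∀ᵐ x ∂μ, δ ≤ f x) : MemLp f⁻¹ ⊤ μ := by
  refine memLp_top_of_bound hf.aemeasurable.inv.aestronglyMeasurable δ⁻¹ ?_
  filter_upwards [hfδ] with x hx
  rw [Pi.inv_apply, norm_inv, Real.norm_of_nonneg (hδ.le.trans hx)]
  gcongr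

theorem re_inner_le_re_inner_of_ae {α 𝕜 E : Type*} {mα : MeasurableSpace α} {μ : Measure α}
    [RCLike 𝕜] [NormedAddCommGroup E] [InnerProductSpace 𝕜 E] {f g h : Lp E 2 μ}
    (hfg : ∀ᵐ x ∂μ, RCLike.re (inner 𝕜 (f x) (h x)) ≤ RCLike.re (inner 𝕜 (g x) (h x))) :
    RCLike.re (inner 𝕜 f h) ≤ RCLike.re (inner 𝕜 g h) := by
  rw [L2.inner_def, L2.inner_def, ← integral_re (L2.integrable_inner f h),
    ← integral_re (L2.integrable_inner g h)]
  exact integral_mono_ae (L2.integrable_inner f h).re (L2.integrable_inner g h).re hfg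

section Potential

variable {n : ℕ} {P : MvPolynomial (Fin n) ℝ} {Ω : Opens (Space n)} {V : Space n → ℝ} {c l : ℝ}
  (hV : MemLp V ⊤ (volume.restrict (Ω : Set (Space n))))
  (hVi : MemLp V⁻¹ ⊤ (volume.restrict (Ω : Set (Space n))))
  (hV0 : ∀ᵐ x ∂(volume.restrict (Ω : Set (Space n))), V x ≠ 0)

/-- Multiplication by a bounded real potential, acting on `L²(Ω)`. -/
def potentialOp : L2 Ω →L[ℂ] L2 Ω :=
  mulL2 (hV.ofReal (K := ℂ))

theorem coeFn_potentialOp (f : L2 Ω) :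
    potentialOp hV f =ᵐ[volume.restrict (Ω : Set (Space n))] fun x => (V x : ℂ) * f x :=
  coeFn_mulL2 _ f

theorem potentialOp_const (h : MemLp (fun _ => c) ⊤ (volume.restrict (Ω : Set (Space n))))
    (f : L2 Ω) : potentialOp h f = (c : ℂ) • f := by
  refine Lp.ext ?_
  filter_upwards [coeFn_potentialOp h f, Lp.coeFn_smul (c : ℂ) f] with x hf hcf
  rw [hf, hcf, Pi.smul_apply, smul_eq_mul]

theorem isSymmetric_potentialOp : (potentialOp hV : L2 Ω →ₗ[ℂ] L2 Ω).IsSymmetric := by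
  intro f g
  change inner ℂ (potentialOp hV f) g = inner ℂ f (potentialOp hV g)
  rw [L2.inner_def, L2.inner_def]
  refine integral_congr_ae ?_
  filter_upwards [coeFn_potentialOp hV f, coeFn_potentialOp hV g] with x hf hg
  rw [hf, hg, RCLike.inner_apply', RCLike.inner_apply', map_mul, Complex.conj_ofReal]
  ring

theorem reApplyInnerSelf_potentialOp_mono {V' : Space n → ℝ}
    (hV' : MemLp V' ⊤ (volume.restrict (Ω : Set (Space n))))
    (h : V ≤ᵐ[volume.restrict (Ω : Set (Space n))] V') (f : L2 Ω) :
    (potentialOp hV).reApplyInnerSelf f ≤ (potentialOp hV').reApplyInnerSelf f := by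
  refine re_inner_le_re_inner_of_ae ?_
  filter_upwards [coeFn_potentialOp hV f, coeFn_potentialOp hV' f, h] with x hf hf' hx
  rw [hf, hf', ← smul_eq_mul, ← smul_eq_mul, inner_smul_left, inner_smul_left,
    Complex.conj_ofReal, Complex.conj_ofReal, RCLike.re_to_complex, RCLike.re_to_complex,
    Complex.re_ofReal_mul, Complex.re_ofReal_mul]
  exact mul_le_mul_of_nonneg_right hx (inner_self_nonneg (𝕜 := ℂ) (x := f x))

theorem reApplyInnerSelf_potentialOp_const
    (h : MemLp (fun _ => c) ⊤ (volume.restrict (Ω : Set (Space n)))) (f : L2 Ω) :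
    (potentialOp h).reApplyInnerSelf f = c * ‖f‖ ^ 2 := by
  rw [ContinuousLinearMap.reApplyInnerSelf_apply, potentialOp_const, inner_smul_left,
    Complex.conj_ofReal, RCLike.re_to_complex, Complex.re_ofReal_mul]
  exact congrArg (c * ·) (inner_self_eq_norm_sq (𝕜 := ℂ) f)

theorem le_reApplyInnerSelf_potentialOp
    (hc : ∀ᵐ x ∂(volume.restrict (Ω : Set (Space n))), c ≤ V x) (f : L2 Ω) :
    c * ‖f‖ ^ 2 ≤ (potentialOp hV).reApplyInnerSelf f :=
  (reApplyInnerSelf_potentialOp_const (memLp_top_const c) f).symm.trans_le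
    (reApplyInnerSelf_potentialOp_mono _ hV hc f)

theorem reApplyInnerSelf_potentialOp_le
    (hc : ∀ᵐ x ∂(volume.restrict (Ω : Set (Space n))), V x ≤ c) (f : L2 Ω) :
    (potentialOp hV).reApplyInnerSelf f ≤ c * ‖f‖ ^ 2 :=
  (reApplyInnerSelf_potentialOp_mono hV _ hc f).trans_eq
    (reApplyInnerSelf_potentialOp_const (memLp_top_const c) f)

include hV0 in
theorem potentialOp_potentialOp_inv (f : L2 Ω) : potentialOp hV (potentialOp hVi f) = f := by
  refine Lp.ext ?_
  filter_upwards [coeFn_potentialOp hV (potentialOp hVi f), coeFn_potentialOp hVi f, hV0]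
    with x hf hfi hx
  rw [hf, hfi, Pi.inv_apply, Complex.ofReal_inv, mul_inv_cancel_left₀ (Complex.ofReal_ne_zero.2 hx)]

include hV0 in
theorem inner_potentialOp_potentialOp_inv (f g : L2 Ω) :
    inner ℂ (potentialOp hV f) (potentialOp hVi g) = inner ℂ f g :=
  (isSymmetric_potentialOp hV f _).trans
    (congrArg (inner ℂ f) (potentialOp_potentialOp_inv hV hVi hV0 g))

theorem weakSol_iff_inner_eq_zero (l : ℝ) (G : L2 Ω) :
    WeakSol P Ω V (l : ℂ) G ↔ ∀ φ : 𝓓(Ω, ℂ), inner ℂ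
      (testToL2 Ω (polyOp P Ω φ) - (l : ℂ) • testToL2 Ω φ + potentialOp hV (testToL2 Ω φ)) G =
        0 := by
  refine forall_congr' fun φ => ?_
  set ψ := testToL2 Ω (polyOp P Ω φ) - (l : ℂ) • testToL2 Ω φ + potentialOp hV (testToL2 Ω φ)
    with hψ
  have hae : (fun x => G x * starRingEnd ℂ
      (polyOp P Ω φ x + (V x : ℂ) * φ x - starRingEnd ℂ (l : ℂ) * φ x))
      =ᵐ[volume.restrict (Ω : Set (Space n))] fun x => inner ℂ (ψ x) (G x) := by
    filter_upwards [coeFn_testToL2 φ, coeFn_testToL2 (polyOp P Ω φ),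
      coeFn_potentialOp hV (testToL2 Ω φ), Lp.coeFn_smul (l : ℂ) (testToL2 Ω φ),
      Lp.coeFn_sub (testToL2 Ω (polyOp P Ω φ)) ((l : ℂ) • testToL2 Ω φ),
      Lp.coeFn_add (testToL2 Ω (polyOp P Ω φ) - (l : ℂ) • testToL2 Ω φ)
        (potentialOp hV (testToL2 Ω φ))] with x hφ hPφ hVφ hsmul hsub hadd
    rw [hψ, hadd, Pi.add_apply, hsub, Pi.sub_apply, hsmul, Pi.smul_apply, hVφ, hφ, hPφ,
      RCLike.inner_apply', smul_eq_mul, Complex.conj_ofReal, mul_comm, sub_add_eq_add_sub]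
  rw [L2.inner_def, ← integral_congr_ae hae]
  exact and_iff_right ((L2.integrable_inner ψ G).congr hae.symm)

/-- The element of `L²(Ω)` represented by `innerFactor`, that is `(1/V) (P - l) u`. -/
def innerFactorL2 (l : ℝ) (u : H0 P Ω) : L2 Ω :=
  potentialOp hVi (pencil (graphFst P Ω) (graphSnd P Ω) l (graphEquiv P Ω u))

theorem innerFactor_ae_eq (l : ℝ) (u : H0 P Ω) :
    innerFactor P Ω V (l : ℂ) u =ᵐ[volume.restrict (Ω : Set (Space n))] innerFactorL2 hVi l u := by
  rw [innerFactorL2, pencil_apply, graphFst_graphEquiv, graphSnd_graphEquiv]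
  filter_upwards [coeFn_potentialOp hVi (minOp P Ω u - (l : ℂ) • (u : L2 Ω)),
    Lp.coeFn_sub (minOp P Ω u) ((l : ℂ) • (u : L2 Ω)), Lp.coeFn_smul (l : ℂ) (u : L2 Ω)]
    with x hfactor hsub hsmul
  change _ = potentialOp hVi (minOp P Ω u - (l : ℂ) • (u : L2 Ω)) x
  rw [hfactor, hsub, Pi.sub_apply, hsmul, Pi.inv_apply, Complex.ofReal_inv]
  rfl

theorem mem_kerT_iff_weakSol_innerFactorL2 (u : H0 P Ω) :
    u ∈ kerT P Ω V (l : ℂ) ↔ WeakSol P Ω V (l : ℂ) (innerFactorL2 hVi l u) :=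
  ⟨fun h => h.congr (innerFactor_ae_eq hVi l u).symm, fun h => h.congr (innerFactor_ae_eq hVi l u)⟩

theorem pencil_testGraph (φ : 𝓓(Ω, ℂ)) :
    pencil (graphFst P Ω) (graphSnd P Ω) l (testGraph P φ) =
      testToL2 Ω (polyOp P Ω φ) - (l : ℂ) • testToL2 Ω φ := rfl

include hV hV0 in
theorem mem_kerT_iff_formOp_eq_zero (u : H0 P Ω) : u ∈ kerT P Ω V (l : ℂ) ↔
    formOp (graphFst P Ω) (graphSnd P Ω) (potentialOp hVi) l (graphEquiv P Ω u) = 0 := by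
  rw [mem_kerT_iff_weakSol_innerFactorL2 hVi, weakSol_iff_inner_eq_zero hV]
  have hinner (φ : 𝓓(Ω, ℂ)) : inner ℂ (testToL2 Ω (polyOp P Ω φ) - (l : ℂ) • testToL2 Ω φ +
      potentialOp hV (testToL2 Ω φ)) (innerFactorL2 hVi l u) =
      starRingEnd ℂ (inner ℂ (formOp (graphFst P Ω) (graphSnd P Ω) (potentialOp hVi) l
        (graphEquiv P Ω u)) (testGraph P φ)) := by
    rw [inner_formOp, map_add, inner_conj_symm, inner_conj_symm, inner_add_left, innerFactorL2,
      inner_potentialOp_potentialOp_inv hV hVi hV0, pencil_testGraph]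
    rfl
  simp only [hinner, map_eq_zero]
  exact ⟨eq_zero_of_inner_testGraph, fun h φ => by rw [h, inner_zero_left]⟩

include hV hV0 in
theorem multiplicity_eq_finrank_ker (l : ℝ) : multiplicity P Ω V l =
    Module.finrank ℂ (formOp (graphFst P Ω) (graphSnd P Ω) (potentialOp hVi) l).ker := by
  have hmap : (kerT P Ω V (l : ℂ)).map (graphEquiv P Ω).toLinearMap =
      (formOp (graphFst P Ω) (graphSnd P Ω) (potentialOp hVi) l).ker := by
    ext z
    obtain ⟨u, rfl⟩ := (graphEquiv P Ω).surjective z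
    exact ((graphEquiv P Ω).injective.mem_set_image).trans
      (mem_kerT_iff_formOp_eq_zero hV hVi hV0 u)
  rw [multiplicity, ← hmap]
  exact (LinearEquiv.finrank_map_eq (graphEquiv P Ω) _).symm

theorem eq_zero_of_ae_norm_pencil_le (hΩ : Bornology.IsBounded (Ω : Set (Space n)))
    (hP : P.totalDegree ≠ 0) {u : H0 P Ω} {M : ℝ}
    (hM : ∀ᵐ x ∂(volume.restrict (Ω : Set (Space n))),
      ‖pencil (graphFst P Ω) (graphSnd P Ω) l (graphEquiv P Ω u) x‖ ≤ M * ‖(u : L2 Ω) x‖) :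
    u = 0 :=
  Subtype.ext (eq_zero_of_mem_minGraph_of_norm_le hΩ hP (coe_minOp_mem_minGraph u) l M hM)

include hV0 in
theorem innerFactorL2_ne_zero (hΩ : Bornology.IsBounded (Ω : Set (Space n)))
    (hP : P.totalDegree ≠ 0) {u : H0 P Ω} (hu : u ≠ 0) : innerFactorL2 hVi l u ≠ 0 := by
  have hinv : ∀ᵐ x ∂(volume.restrict (Ω : Set (Space n))), (((V⁻¹ x : ℝ)) : ℂ) ≠ 0 :=
    hV0.mono fun x hx => Complex.ofReal_ne_zero.2 (inv_ne_zero hx)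
  intro h
  have hpencil := injective_mulL2 _ hinv (h.trans (map_zero _).symm)
  refine hu (eq_zero_of_ae_norm_pencil_le (l := l) (M := 0) hΩ hP ?_)
  filter_upwards [Lp.eq_zero_iff_ae_eq_zero.1 hpencil] with x hx
  rw [hx, Pi.zero_apply, norm_zero, zero_mul]

include hV hV0 in
theorem innerFactorL2_add_ne_zero (hΩ : Bornology.IsBounded (Ω : Set (Space n)))
    (hP : P.totalDegree ≠ 0) {u : H0 P Ω} (hu : u ≠ 0) :
    innerFactorL2 hVi l u + (u : L2 Ω) ≠ 0 := by
  intro h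
  have hpencil : pencil (graphFst P Ω) (graphSnd P Ω) l (graphEquiv P Ω u) =
      potentialOp hV (-(u : L2 Ω)) := by
    rw [← eq_neg_of_add_eq_zero_left h, innerFactorL2, potentialOp_potentialOp_inv hV hVi hV0]
  obtain ⟨M, -, hM⟩ := exists_pos_ae_norm_le_of_memLp_top hV
  refine hu (eq_zero_of_ae_norm_pencil_le (l := l) (M := M) hΩ hP ?_)
  rw [hpencil]
  filter_upwards [coeFn_potentialOp hV (-(u : L2 Ω)), Lp.coeFn_neg (u : L2 Ω), hM]
    with x hx hneg hMx
  rw [hx, hneg, Pi.neg_apply, norm_mul, norm_neg, Complex.norm_real]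
  gcongr

include hV hV0 in
theorem weakSol_zero_innerFactorL2_add {u : H0 P Ω} (hu : u ∈ kerT P Ω V (l : ℂ)) :
    WeakSol P Ω 0 (l : ℂ) (innerFactorL2 hVi l u + (u : L2 Ω) : L2 Ω) := by
  refine (weakSol_iff_inner_eq_zero (memLp_top_const 0) l _).2 fun φ => ?_
  have hw := (weakSol_iff_inner_eq_zero hV l _).1
    ((mem_kerT_iff_weakSol_innerFactorL2 hVi u).1 hu) φ
  rw [inner_add_left] at hw
  have hsymm := inner_pencil_symm (l := l) inner_graphSnd_symm (testGraph P φ) (graphEquiv P Ω u)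
  rw [pencil_testGraph, graphFst_graphEquiv] at hsymm
  rw [potentialOp_const, Complex.ofReal_zero, zero_smul, add_zero, inner_add_right, hsymm, ← hw]
  congr 1
  exact (inner_potentialOp_potentialOp_inv hV hVi hV0 _ _).symm

include hV hVi hV0 in
theorem isTransmissionEigenvalue_of_multiplicity_ne_zero
    (hΩ : Bornology.IsBounded (Ω : Set (Space n))) (hP : P.totalDegree ≠ 0)
    (hl : multiplicity P Ω V l ≠ 0) : IsTransmissionEigenvalue P Ω V (l : ℂ) := by
  have := Module.nontrivial_of_finrank_pos (Nat.pos_of_ne_zero hl)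
  obtain ⟨⟨u, hu⟩, hu0⟩ := exists_ne (0 : kerT P Ω V (l : ℂ))
  replace hu0 : u ≠ 0 := fun h => hu0 (Subtype.ext h)
  set w := innerFactorL2 hVi l u
  have hL2 (f : L2 Ω) : L2Loc Ω f := fun K _ hKΩ =>
    (Lp.memLp f).mono_measure (Measure.restrict_mono hKΩ le_rfl)
  refine ⟨(w + (u : L2 Ω) : L2 Ω), w, hL2 _, hL2 _,
    mt Lp.eq_zero_iff_ae_eq_zero.2 (innerFactorL2_add_ne_zero hV hVi hV0 hΩ hP hu0),
    mt Lp.eq_zero_iff_ae_eq_zero.2 (innerFactorL2_ne_zero hVi hV0 hΩ hP hu0),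
    weakSol_zero_innerFactorL2_add hV hVi hV0 hu,
    (mem_kerT_iff_weakSol_innerFactorL2 hVi u).1 hu, u, ?_⟩
  filter_upwards [Lp.coeFn_add w (u : L2 Ω)] with x hx
  rw [Pi.sub_apply, hx, Pi.add_apply, add_sub_cancel_left]

end Potential

theorem two_mul_norm_graphSnd_graphEquiv_le {n : ℕ} {P : MvPolynomial (Fin n) ℝ}
    {Ω : Opens (Space n)} {u : H0 P Ω} {δ : ℝ}
    (hu : u ≠ 0 → 2 * (‖minOp P Ω u‖ / ‖(u : L2 Ω)‖) ≤ δ) :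
    2 * ‖graphSnd P Ω (graphEquiv P Ω u)‖ ≤ δ * ‖graphFst P Ω (graphEquiv P Ω u)‖ := by
  rcases eq_or_ne u 0 with rfl | h
  · simp only [map_zero, norm_zero, mul_zero, le_refl]
  · rw [graphSnd_graphEquiv, graphFst_graphEquiv]
    have hpos : 0 < ‖(u : L2 Ω)‖ := norm_pos_iff.2 (mt Submodule.coe_eq_zero.1 h)
    rw [← div_le_iff₀ hpos, mul_div_assoc]
    exact hu h

end

end TransmissionProblem

open TransmissionProblem in
theorem lemma4p4_general {n : ℕ} {P : MvPolynomial (Fin n) ℝ} (hP : P.totalDegree ≠ 0)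
    (hPinf : Tendsto (symbolTilde P) (cocompact (Space n)) atTop)
    (hPbdd : (∃ c : ℝ, ∀ ξ, c ≤ symbol P ξ) ∨ ∃ c : ℝ, ∀ ξ, c ≤ -symbol P ξ)
    {Ω : Opens (Space n)} (hΩ : Bornology.IsBounded (Ω : Set (Space n))) {V : Space n → ℝ}
    (hV : MemLp V ⊤ (volume.restrict (Ω : Set (Space n)))) {δ : ℝ} (hδ : 0 < δ)
    (hVδ : ∀ᵐ x ∂(volume.restrict (Ω : Set (Space n))), δ ≤ V x) (W : Submodule ℂ (H0 P Ω))
    (hW : ∀ u ∈ W, u ≠ 0 → 2 * (‖minOp P Ω u‖ / ‖(u : L2 Ω)‖) ≤ δ) :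
    ∃ ev : Fin (Module.finrank ℂ W) → ℝ,
      (∀ i, IsTransmissionEigenvalue P Ω V (ev i : ℂ)) ∧
      ∀ i, (Finset.univ.filter fun j => ev j = ev i).card ≤ multiplicity P Ω V (ev i) := by
  obtain ⟨M, hM, hVM⟩ := exists_pos_ae_norm_le_of_memLp_top hV
  have hV0 := hVδ.mono fun x hx => (hδ.trans_le hx).ne'
  have hVi := memLp_top_inv hV.1 hδ hVδ
  have hVi_le := hVδ.mono fun x hx => inv_anti₀ hδ hx
  have hle_Vi := (hVδ.and hVM).mono fun x hx =>
    inv_anti₀ (hδ.trans_le hx.1) ((Real.le_norm_self _).trans hx.2)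
  have hWδ : ∀ z ∈ W.map (graphEquiv P Ω).toLinearMap,
      2 * ‖graphSnd P Ω z‖ ≤ δ * ‖graphFst P Ω z‖ := by
    rintro _ ⟨u, hu, rfl⟩
    exact two_mul_norm_graphSnd_graphEquiv_le (hW u hu)
  have hev := exists_kernels_formOp inner_graphSnd_symm graphFst_injective
    (fun u => (norm_sq_graphSpace u).le)
    (fun ε hε => exists_finite_rank_estimate_graphSpace hΩ hPinf hε)
    (semibounded_graphSnd hPbdd) (isSymmetric_potentialOp hVi) (inv_pos.2 hM)
    (le_reApplyInnerSelf_potentialOp hVi hle_Vi) hδ (reApplyInnerSelf_potentialOp_le hVi hVi_le) hWδ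
  rw [LinearEquiv.finrank_map_eq] at hev
  obtain ⟨ev, hev⟩ := hev
  simp only [← multiplicity_eq_finrank_ker hV hVi hV0] at hev
  exact ⟨ev, fun i => isTransmissionEigenvalue_of_multiplicity_ne_zero hV hVi hV0 hΩ hP
    ((Finset.card_pos.2 ⟨i, by simp⟩).trans_le (hev i)).ne', hev⟩

theorem lemma4p4 {n : ℕ} (P : MvPolynomial (Fin n) ℝ) (hP : 2 ≤ P.totalDegree)
    (hPinf : Filter.Tendsto (TransmissionProblem.symbolTilde P)
      (Filter.cocompact (EuclideanSpace ℝ (Fin n))) Filter.atTop)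
    (hPbdd : (∃ c : ℝ, ∀ ξ, c ≤ TransmissionProblem.symbol P ξ) ∨
      (∃ c : ℝ, ∀ ξ, c ≤ -TransmissionProblem.symbol P ξ))
    (Ω : TopologicalSpace.Opens (EuclideanSpace ℝ (Fin n)))
    (hΩc : IsConnected (Ω : Set (EuclideanSpace ℝ (Fin n))))
    (hΩb : Bornology.IsBounded (Ω : Set (EuclideanSpace ℝ (Fin n))))
    (V : EuclideanSpace ℝ (Fin n) → ℝ) (hV : MemLp V ⊤ volume)
    (hVsupp : TransmissionProblem.essSupport V = closure (Ω : Set (EuclideanSpace ℝ (Fin n))))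
    (δ : ℝ) (hδ : 0 < δ)
    (hVδ : ∀ᵐ x ∂(volume.restrict (closure (Ω : Set (EuclideanSpace ℝ (Fin n))))), δ ≤ V x)
    (p : ℕ) (W : Submodule ℂ (TransmissionProblem.H0 P Ω)) (hWp : Module.finrank ℂ W = p)
    (hW : ∀ u ∈ W, u ≠ 0 →
      2 * (‖TransmissionProblem.minOp P Ω u‖ /
        ‖(u : TransmissionProblem.L2 Ω)‖) ≤ δ) :
    ∃ ev : Fin p → ℝ,
      (∀ i, TransmissionProblem.IsTransmissionEigenvalue P Ω V (ev i : ℂ)) ∧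
      ∀ i, (Finset.univ.filter fun j => ev j = ev i).card ≤
        TransmissionProblem.multiplicity P Ω V (ev i) := by
  subst hWp
  exact lemma4p4_general (by omega) hPinf hPbdd hΩb (hV.restrict _) hδ
    (ae_restrict_of_ae_restrict_of_subset subset_closure hVδ) W hW
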